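/- Let $p$ be a prime. Let $G=\mathbb{Q}_p$ with Haar measure $m$ normalized by $m(\mathbb{Z}_p)=1$, $H=\mathbb{R}$, $\Gamma=\{(\gamma,\gamma):\gamma\in\mathbb{Z}[1/p]\}\subset\mathbb{Q}_p\times\mathbb{R}$ and $W=[-1/2,1/2]$. Then $\Gamma$ is a lattice in $\mathbb{Q}_p\times\mathbb{R}$ that projects injectively to $\mathbb{Q}_p$ and densely to $\mathbb{R}$, the set $W$ is relatively compact with dense (and non-empty) interior, and $\Omega=(\mathbb{Q}_p\times\mathbb{R})/\Gamma$ carries a unique Borel probability measure $\mathbb{P}$ that is invariant under the action $t.[(g,h)]=[(t+g,h)]$ of $\mathbb{Q}_p$. Consider on $(\Omega,\mathbb{P})$ the cut-and-project process $$\omega=[(g,h)]\mapsto X_\omega=\sum_{x\in\Lambda_\omega}\delta_x,\qquad \Lambda_{[(g,h)]}=\mathrm{pr}_{\mathbb{Q}_p}\bigl(\Gamma\cap(\mathbb{Q}_p\times(W-h))\bigr)+g .$$ Let $X$ be a locally square-integrable invariant point process on a locally compact second countable abelian group $G$ with Haar measure $m$. Its intensity is the number $i\ge 0$ with $\mathbb{E}[X_\omega(A)]=i\,m(A)$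 for all Borel $A$; its autocorrelation is the Radon measure $\eta^+$ on $G$ with $\mathbb{E}[(X_\omega\otimes X_\omega)(F)]=\int_G\int_G F(x+t,t)\,dm(t)\,d\eta^+(x)$ for all non-negative Borel functions $F$ on $G\times G$; and its centered diffraction is the Fourier transform $\widehat\eta$ of $\eta=\eta^+-i^2m$, that is, the positive Radon measure on $\widehat G$ with $\widehat\eta(|\widehat f|^2)=\eta(f*f^*)$ for all $f\in C_c(G)$, where $f^*(x)=\overline{f(-x)}$ and $\widehat f(\chi)=\int_G f\,\overline{\chi}\,dm$. The process is called stealthy if $\widehat\eta$ vanishes on some non-empty open subset of $\widehat G$. Identify $\mathbb{Q}_p$ with its Pontryagin dual by $y\mapsto\alpha_y$, where $\alpha_y(x)=e^{2\pi i\{yx\}_p}$ and $\{z\}_p$ is any element of $\mathbb{Z}[1/p]$ with $z-\{z\}_p\in\mathbb{Z}_p$. Then the cut-and-project process above is a locally square-integrable invariant simple point process, its centered diffraction exists and vanishes on $\mathbb{Z}_p$, i.e. $\widehat\eta(\{\alpha_y:y\in\mathbb{Z}_p\})=0$, and the process is stealthy. -/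

import Mathlib

open MeasureTheory
open scoped ENNReal NNReal Convolution Pointwise

noncomputable section

/-! ### Random measures and point processes

`G` is a locally compact second countable abelian group, written additively. Invariant random
measures are here positive (point processes are), so they take values in `Measure G`, whose
`σ`-algebra is generated by the evaluations on Borel sets. -/

/-- `P` is a probability measure that is invariant under the action of `G` on `Ω`. -/
structure IsInvariantProbability (G : Type*) {Ω : Type*} [AddMonoid G] [MeasurableSpace Ω]
    [AddAction G Ω] (P : Measure Ω) : Prop where
  prob : IsProbabilityMeasure P
  invariant : ∀ g : G, MeasurePreserving (fun ω : Ω => g +ᵥ ω) P P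

/-- An invariant random (positive) measure on `G`: a measurable `G`-equivariant map from a
probability space with a measure preserving `G`-action to the Radon measures on `G`. -/
structure IsInvariantRandomMeasure {Ω G : Type*} [MeasurableSpace Ω] [AddCommGroup G]
    [TopologicalSpace G] [MeasurableSpace G] [AddAction G Ω]
    (P : Measure Ω) (X : Ω → Measure G) : Prop where
  invariantProbability : IsInvariantProbability G P
  measurable : Measurable X
  radon : ∀ ω, IsFiniteMeasureOnCompacts (X ω)
  equivariant : ∀ (g : G) (ω : Ω), X (g +ᵥ ω) = (X ω).map (fun x => g + x)

/-- The counting measure `δ_S = ∑_{x ∈ S} δ_x`. -/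
def diracComb {G : Type*} [MeasurableSpace G] (S : Set G) : Measure G :=
  Measure.sum fun x : S => Measure.dirac (x : G)

/-- The random measure is almost surely carried by a locally finite set, and all its atoms have
mass one; that is, it is almost surely of the form `δ_S` with `S` locally finite. -/
def IsSimplePointProcess {Ω G : Type*} [MeasurableSpace Ω] [TopologicalSpace G]
    [MeasurableSpace G] (P : Measure Ω) (X : Ω → Measure G) : Prop :=
  ∀ᵐ ω ∂P, ∃ S : Set G, (∀ K : Set G, IsCompact K → (K ∩ S).Finite) ∧ X ω = diracComb S

/-- `E[X_ω(B)²] < ∞` for every bounded (that is, relatively compact) Borel set `B`. -/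
def IsLocallySquareIntegrable {Ω G : Type*} [MeasurableSpace Ω] [TopologicalSpace G]
    [MeasurableSpace G] (P : Measure Ω) (X : Ω → Measure G) : Prop :=
  ∀ B : Set G, MeasurableSet B → IsCompact (closure B) → ∫⁻ ω, (X ω B) ^ 2 ∂P < ∞

/-! ### Moment measures, autocorrelation and diffraction -/

/-- The first moment measure `M¹(A) = E[X_ω(A)]`. -/
def firstMoment {Ω G : Type*} [MeasurableSpace Ω] [MeasurableSpace G]
    (P : Measure Ω) (X : Ω → Measure G) : Measure G :=
  P.bind X

/-- The second moment measure `M²(B) = E[(X_ω ⊗ X_ω)(B)]`. -/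
def secondMoment {Ω G : Type*} [MeasurableSpace Ω] [MeasurableSpace G]
    (P : Measure Ω) (X : Ω → Measure G) : Measure (G × G) :=
  P.bind fun ω => (X ω).prod (X ω)

/-- `i` is the intensity of `X` with respect to the Haar measure `m`: `M¹ = i • m`. -/
def IsIntensity {Ω G : Type*} [MeasurableSpace Ω] [MeasurableSpace G]
    (m : Measure G) (P : Measure Ω) (X : Ω → Measure G) (i : ℝ≥0) : Prop :=
  firstMoment P X = i • m

/-- `η` is the autocorrelation of `X`: the Radon measure on `G` that corresponds to the invariant
measure `M²` under the identification of `(G × G) / Δ(G)` with `G` by `(g₁, g₂) ↦ g₁ - g₂`, i.e.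
`∫ F dM² = ∫ ∫ F (x + t, t) dm(t) dη(x)`. In particular `M²(f₁ ⊗ f₂) = η(f₁ * f̌₂)`. -/
structure IsAutocorrelation {Ω G : Type*} [MeasurableSpace Ω] [AddCommGroup G]
    [TopologicalSpace G] [MeasurableSpace G]
    (m : Measure G) (P : Measure Ω) (X : Ω → Measure G) (η : Measure G) : Prop where
  radon : IsFiniteMeasureOnCompacts η
  secondMoment_eq : secondMoment P X = (η.prod m).map (fun z : G × G => (z.1 + z.2, z.2))

/-- The value at `f` of the signed Radon measure `η - i² • m`. If `η` is the autocorrelation and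
`i` the intensity of a random measure, this is its centered autocorrelation. -/
def centeredIntegral {G : Type*} [MeasurableSpace G] (m η : Measure G) (i : ℝ≥0) (f : G → ℂ) : ℂ :=
  (∫ x, f x ∂η) - ((i : ℝ) : ℂ) ^ 2 * ∫ x, f x ∂m

/-- The Pontryagin dual of an additive group: continuous characters with the compact-open
topology. -/
abbrev AddDual (G : Type*) [AddCommGroup G] [TopologicalSpace G] : Type _ :=
  PontryaginDual (Multiplicative G)

instance AddDual.instMeasurableSpace (G : Type*) [AddCommGroup G] [TopologicalSpace G] :
    MeasurableSpace (AddDual G) :=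
  borel _

instance AddDual.instBorelSpace (G : Type*) [AddCommGroup G] [TopologicalSpace G] :
    BorelSpace (AddDual G) :=
  ⟨rfl⟩

/-- The Fourier transform `f̂(χ) = ∫ f(x) conj(χ(x)) dm(x)`. -/
def dualFourier {G : Type*} [AddCommGroup G] [TopologicalSpace G] [MeasurableSpace G]
    (m : Measure G) (f : G → ℂ) (χ : AddDual G) : ℂ :=
  ∫ x, f x * (starRingEnd ℂ) ((χ (Multiplicative.ofAdd x) : Circle) : ℂ) ∂m

/-- The involution `f*(x) = conj(f(-x))`. -/
def starInvolution {G : Type*} [AddCommGroup G] (f : G → ℂ) (x : G) : ℂ :=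
  (starRingEnd ℂ) (f (-x))

/-- The positive Radon measure `ν` on the dual group is the Fourier transform of the positive
definite signed Radon measure that is given by the functional `L`: for all `f ∈ C_c(G)`,
`|f̂|²` is `ν`-integrable and `ν(|f̂|²) = L(f * f*)`. -/
structure IsMeasureFourierTransform {G : Type*} [AddCommGroup G] [TopologicalSpace G]
    [MeasurableSpace G] (m : Measure G) (L : (G → ℂ) → ℂ) (ν : Measure (AddDual G)) : Prop where
  radon : IsFiniteMeasureOnCompacts ν
  integrable : ∀ f : G → ℂ, Continuous f → HasCompactSupport f →
    Integrable (fun χ => ‖dualFourier m f χ‖ ^ 2) ν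
  integral_eq : ∀ f : G → ℂ, Continuous f → HasCompactSupport f →
    ((∫ χ, ‖dualFourier m f χ‖ ^ 2 ∂ν : ℝ) : ℂ) =
      L (f ⋆[ContinuousLinearMap.mul ℂ ℂ, m] starInvolution f)

/-- `ν` is the centered diffraction of `X` (with respect to the Haar measure `m` on `G`): the
Fourier transform of the centered autocorrelation of `X`. -/
def IsCenteredDiffraction {Ω G : Type*} [MeasurableSpace Ω] [AddCommGroup G]
    [TopologicalSpace G] [MeasurableSpace G]
    (m : Measure G) (P : Measure Ω) (X : Ω → Measure G) (ν : Measure (AddDual G)) : Prop :=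
  ∃ (i : ℝ≥0) (η : Measure G), IsIntensity m P X i ∧ IsAutocorrelation m P X η ∧
    IsMeasureFourierTransform m (centeredIntegral m η i) ν

/-- A stealthy point process: a locally square-integrable invariant simple point process whose
centered diffraction vanishes on some non-empty open set. -/
structure IsStealthy {Ω G : Type*} [MeasurableSpace Ω] [AddCommGroup G] [TopologicalSpace G]
    [MeasurableSpace G] [AddAction G Ω]
    (m : Measure G) (P : Measure Ω) (X : Ω → Measure G) : Prop where
  randomMeasure : IsInvariantRandomMeasure P X
  pointProcess : IsSimplePointProcess P X
  squareIntegrable : IsLocallySquareIntegrable P X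
  vanishing : ∃ ν : Measure (AddDual G), IsCenteredDiffraction m P X ν ∧
    ∃ U : Set (AddDual G), IsOpen U ∧ U.Nonempty ∧ ν U = 0

/-! ### Cut-and-project processes -/

section CutAndProject

/-- A lattice in `L`: a discrete subgroup such that the quotient carries an `L`-invariant
probability measure. -/
def IsLatticeIn {L : Type*} [AddCommGroup L] [TopologicalSpace L] [MeasurableSpace L]
    (Γ : AddSubgroup L) : Prop :=
  DiscreteTopology Γ ∧ ∃ Q : Measure (L ⧸ Γ), IsInvariantProbability L Q

/-- The assumptions on the parameters `(G, H, Γ, W)` of a cut-and-project process. -/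
structure IsCutAndProjectDatum {G H : Type*} [AddCommGroup G] [TopologicalSpace G]
    [MeasurableSpace G] [AddCommGroup H] [TopologicalSpace H] [MeasurableSpace H]
    (Γ : AddSubgroup (G × H)) (W : Set H) : Prop where
  lattice : IsLatticeIn Γ
  injective : Set.InjOn Prod.fst (Γ : Set (G × H))
  dense : Dense (Prod.snd '' (Γ : Set (G × H)))
  compact : IsCompact (closure W)
  interior_nonempty : (interior W).Nonempty
  interior_dense : W ⊆ closure (interior W)

/-- The action of `G` on `Ω = (G × H) / Γ` by `t + [(g, h)] = [(t + g, h)]`. -/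
instance cutAndProjectAction {G H : Type*} [AddCommGroup G] [AddCommGroup H]
    (Γ : AddSubgroup (G × H)) : AddAction G ((G × H) ⧸ Γ) :=
  AddAction.compHom _ (AddMonoidHom.inl G H)

/-- The cut-and-project set `Λ(G, H, Γ, W) = pr_G(Γ ∩ (G × W))`. -/
def cutAndProjectSet {G H : Type*} [AddCommGroup G] [AddCommGroup H]
    (Γ : AddSubgroup (G × H)) (W : Set H) : Set G :=
  Prod.fst '' ((Γ : Set (G × H)) ∩ (Set.univ ×ˢ W))

/-- The random set `Λ_{[(g, h)]} = Λ(G, H, Γ, W - h) + g`. -/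
def randomCutAndProjectSet {G H : Type*} [AddCommGroup G] [AddCommGroup H]
    (Γ : AddSubgroup (G × H)) (W : Set H) : (G × H) ⧸ Γ → Set G :=
  Quotient.lift
    (fun z : G × H => (fun x => x + z.1) '' cutAndProjectSet Γ ((fun y => y - z.2) '' W))
    (by
      have key : ∀ z z' : G × H, -z + z' ∈ Γ →
          ((fun x => x + z.1) '' cutAndProjectSet Γ ((fun y => y - z.2) '' W)) ⊆
          ((fun x => x + z'.1) '' cutAndProjectSet Γ ((fun y => y - z'.2) '' W)) := by
        rintro z z' hz _ ⟨_, ⟨γ, ⟨hγ, -, w, hw, hwγ⟩, rfl⟩, rfl⟩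
        refine ⟨_, ⟨γ - (-z + z'), ⟨Γ.sub_mem hγ hz, Set.mem_univ _, w, hw, ?_⟩, rfl⟩, ?_⟩
        · have h : w - z.2 = γ.2 := hwγ
          simp only [Prod.snd_sub, Prod.snd_add, Prod.snd_neg, ← h]
          abel
        · simp only [Prod.fst_sub, Prod.fst_add, Prod.fst_neg]
          abel
      intro z z' h
      have h1 : -z + z' ∈ Γ := QuotientAddGroup.leftRel_apply.mp h
      have h2 : -z' + z ∈ Γ := by
        have := Γ.neg_mem h1
        simpa [add_comm] using this
      exact Set.Subset.antisymm (key z z' h1) (key z' z h2))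

/-- The cut-and-project process `p(G, H, Γ, W) : Ω → M(G)`, `ω ↦ δ_{Λ_ω}`. -/
def cutAndProjectProcess {G H : Type*} [AddCommGroup G] [AddCommGroup H] [MeasurableSpace G]
    (Γ : AddSubgroup (G × H)) (W : Set H) (ω : (G × H) ⧸ Γ) : Measure G :=
  diracComb (randomCutAndProjectSet Γ W ω)

end CutAndProject

/-! ### The `p`-adic example -/

section PadicExample

instance Padic.instMeasurableSpaceBorel (p : ℕ) [Fact p.Prime] : MeasurableSpace ℚ_[p] :=
  borel _

instance Padic.instBorelSpaceBorel (p : ℕ) [Fact p.Prime] : BorelSpace ℚ_[p] :=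
  ⟨rfl⟩

/-- The subset `ℤ_p` of `ℚ_p`. -/
def padicUnitBall (p : ℕ) [Fact p.Prime] : Set ℚ_[p] :=
  {x | ‖x‖ ≤ 1}

theorem padicUnitBall_eq (p : ℕ) [Fact p.Prime] :
    padicUnitBall p = Metric.closedBall (0 : ℚ_[p]) 1 := by
  ext x
  simp [padicUnitBall]

/-- `ℤ_p` as a compact set with non-empty interior. -/
def padicUnitCompact (p : ℕ) [Fact p.Prime] : TopologicalSpace.PositiveCompacts ℚ_[p] where
  carrier := padicUnitBall p
  isCompact' := by
    rw [padicUnitBall_eq]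
    exact isCompact_closedBall _ _
  interior_nonempty' := by
    rw [padicUnitBall_eq]
    exact ⟨0, Metric.ball_subset_interior_closedBall (Metric.mem_ball_self one_pos)⟩

/-- The Haar measure on `ℚ_p` with `m(ℤ_p) = 1`. -/
def padicHaar (p : ℕ) [Fact p.Prime] : Measure ℚ_[p] :=
  Measure.addHaarMeasure (padicUnitCompact p)

/-- The group `ℤ[1/p] = {k / p ^ n}` of rational numbers. -/
def intInvP (p : ℕ) [hp : Fact p.Prime] : AddSubgroup ℚ where
  carrier := {q | ∃ (k : ℤ) (n : ℕ), q = k / (p : ℚ) ^ n}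
  zero_mem' := ⟨0, 0, by simp⟩
  add_mem' := by
    rintro _ _ ⟨k, n, rfl⟩ ⟨l, m, rfl⟩
    have h : (p : ℚ) ≠ 0 := Nat.cast_ne_zero.mpr hp.out.ne_zero
    exact ⟨k * (p : ℤ) ^ m + (p : ℤ) ^ n * l, n + m, by
      rw [div_add_div _ _ (pow_ne_zero _ h) (pow_ne_zero _ h), pow_add]
      push_cast
      rfl⟩
  neg_mem' := by
    rintro _ ⟨k, n, rfl⟩
    exact ⟨-k, n, by push_cast; rw [neg_div]⟩

/-- The lattice `Γ = {(γ, γ) : γ ∈ ℤ[1/p]}` in `ℚ_p × ℝ`. -/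
def padicLattice (p : ℕ) [Fact p.Prime] : AddSubgroup (ℚ_[p] × ℝ) :=
  (intInvP p).map
    ((Rat.castHom ℚ_[p]).toAddMonoidHom.prod (Rat.castHom ℝ).toAddMonoidHom)

/-- The window `[-1/2, 1/2]`. -/
def halfWindow : Set ℝ :=
  Set.Icc (-1 / 2) (1 / 2)

theorem exists_padicFract (p : ℕ) [hp : Fact p.Prime] (x : ℚ_[p]) :
    ∃ r ∈ intInvP p, ‖x - (r : ℚ_[p])‖ ≤ 1 := by
  have hp1 : (1 : ℝ) < p := by exact_mod_cast hp.out.one_lt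
  have hp0 : (0 : ℝ) < p := one_pos.trans hp1
  have hpp : (p : ℚ_[p]) ≠ 0 := Nat.cast_ne_zero.mpr hp.out.ne_zero
  obtain ⟨n, hn⟩ := pow_unbounded_of_one_lt ‖x‖ hp1
  have hnorm : ‖(p : ℚ_[p]) ^ n‖ = ((p : ℝ) ^ n)⁻¹ := by
    rw [norm_pow, Padic.norm_p, inv_pow]
  have hy : ‖(p : ℚ_[p]) ^ n * x‖ ≤ 1 := by
    rw [norm_mul, hnorm, inv_mul_le_iff₀ (pow_pos hp0 n), mul_one]
    exact hn.le
  obtain ⟨y, hyx⟩ : ∃ y : ℤ_[p], (y : ℚ_[p]) = (p : ℚ_[p]) ^ n * x := ⟨⟨_, hy⟩, rfl⟩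
  obtain ⟨k, hk⟩ := PadicInt.denseRange_natCast.exists_dist_lt y (inv_pos.mpr (pow_pos hp0 n))
  rw [dist_eq_norm, PadicInt.norm_def, PadicInt.coe_sub, hyx, PadicInt.coe_natCast] at hk
  refine ⟨(k : ℤ) / (p : ℚ) ^ n, ⟨k, n, rfl⟩, ?_⟩
  have hx : x - (((k : ℤ) / (p : ℚ) ^ n : ℚ) : ℚ_[p]) =
      ((p : ℚ_[p]) ^ n * x - k) / (p : ℚ_[p]) ^ n := by
    push_cast
    field_simp
  rw [hx, norm_div, hnorm, div_inv_eq_mul]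
  calc _ ≤ ((p : ℝ) ^ n)⁻¹ * (p : ℝ) ^ n := by gcongr
    _ = 1 := inv_mul_cancel₀ (pow_pos hp0 n).ne'

theorem exists_int_of_norm_le_one (p : ℕ) [hp : Fact p.Prime] {r : ℚ} (hr : r ∈ intInvP p)
    (h : ‖(r : ℚ_[p])‖ ≤ 1) : ∃ k : ℤ, r = k := by
  obtain ⟨k, n, rfl⟩ := hr
  have hp0 : (0 : ℝ) < p := by exact_mod_cast hp.out.pos
  have hpq : (p : ℚ) ≠ 0 := Nat.cast_ne_zero.mpr hp.out.ne_zero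
  have hk : ‖(k : ℚ_[p])‖ ≤ (p : ℝ) ^ (-(n : ℤ)) := by
    push_cast at h
    rw [norm_div, norm_pow, Padic.norm_p, inv_pow, div_inv_eq_mul] at h
    rw [zpow_neg, zpow_natCast, ← one_div, le_div_iff₀ (pow_pos hp0 n)]
    exact h
  obtain ⟨l, rfl⟩ := (Padic.norm_int_le_pow_iff_dvd k n).mp hk
  refine ⟨l, ?_⟩
  push_cast
  rw [mul_div_assoc, mul_comm, div_mul_cancel₀ _ (pow_ne_zero _ hpq)]

/-- A representative in `ℤ[1/p]` of the fractional part `{x}_p ∈ ℤ[1/p] / ℤ` of `x ∈ ℚ_p`, that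
is, an element `r` of `ℤ[1/p]` with `x - r ∈ ℤ_p`. -/
def padicFract (p : ℕ) [Fact p.Prime] (x : ℚ_[p]) : ℚ :=
  (exists_padicFract p x).choose

theorem padicFract_mem (p : ℕ) [Fact p.Prime] (x : ℚ_[p]) : padicFract p x ∈ intInvP p :=
  (exists_padicFract p x).choose_spec.1

theorem norm_sub_padicFract (p : ℕ) [Fact p.Prime] (x : ℚ_[p]) :
    ‖x - (padicFract p x : ℚ_[p])‖ ≤ 1 :=
  (exists_padicFract p x).choose_spec.2

/-- The standard character `α(x) = exp(2πi {x}_p)` of `ℚ_p`. -/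
def padicAlpha (p : ℕ) [Fact p.Prime] (x : ℚ_[p]) : Circle :=
  Circle.exp (2 * Real.pi * (padicFract p x : ℝ))

theorem circleExp_eq_of_sub_int {a b : ℚ} (h : ∃ k : ℤ, a - b = k) :
    Circle.exp (2 * Real.pi * (a : ℝ)) = Circle.exp (2 * Real.pi * (b : ℝ)) := by
  obtain ⟨k, hk⟩ := h
  rw [Circle.exp_eq_exp]
  refine ⟨k, ?_⟩
  have : (a : ℝ) = b + k := by
    have h2 : a = b + k := by linarith
    rw [h2]
    push_cast
    rfl
  rw [this]
  ring

/-- `α(x)` does not depend on the representative of the fractional part. -/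
theorem padicAlpha_eq (p : ℕ) [Fact p.Prime] (x : ℚ_[p]) (r : ℚ) (hr : r ∈ intInvP p)
    (h : ‖x - (r : ℚ_[p])‖ ≤ 1) : padicAlpha p x = Circle.exp (2 * Real.pi * (r : ℝ)) := by
  refine circleExp_eq_of_sub_int
    (exists_int_of_norm_le_one p ((intInvP p).sub_mem (padicFract_mem p x) hr) ?_)
  have : ((padicFract p x - r : ℚ) : ℚ_[p]) =
      (x - (r : ℚ_[p])) - (x - (padicFract p x : ℚ_[p])) := by
    push_cast
    ring
  rw [this, sub_eq_add_neg]
  refine (Padic.nonarchimedean _ _).trans (max_le h ?_)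
  rw [norm_neg]
  exact norm_sub_padicFract p x

theorem padicAlpha_add (p : ℕ) [Fact p.Prime] (x y : ℚ_[p]) :
    padicAlpha p (x + y) = padicAlpha p x * padicAlpha p y := by
  rw [padicAlpha_eq p (x + y) (padicFract p x + padicFract p y)
    ((intInvP p).add_mem (padicFract_mem p x) (padicFract_mem p y)), padicAlpha, padicAlpha,
    ← Circle.exp_add]
  · congr 1
    push_cast
    ring
  · have : x + y - ((padicFract p x + padicFract p y : ℚ) : ℚ_[p]) =
        (x - (padicFract p x : ℚ_[p])) + (y - (padicFract p y : ℚ_[p])) := by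
      push_cast
      ring
    rw [this]
    exact (Padic.nonarchimedean _ _).trans
      (max_le (norm_sub_padicFract p x) (norm_sub_padicFract p y))

theorem padicAlpha_eq_one (p : ℕ) [Fact p.Prime] (x : ℚ_[p]) (h : ‖x‖ ≤ 1) :
    padicAlpha p x = 1 := by
  rw [padicAlpha_eq p x 0 (intInvP p).zero_mem (by simpa using h)]
  simp

theorem continuous_padicAlpha (p : ℕ) [Fact p.Prime] : Continuous (padicAlpha p) := by
  rw [continuous_iff_continuousAt]
  intro x
  have : padicAlpha p =ᶠ[nhds x] fun _ => padicAlpha p x := by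
    filter_upwards [Metric.ball_mem_nhds x one_pos] with y hy
    have h : ‖y - x‖ ≤ 1 := by
      rw [← dist_eq_norm]
      exact (Metric.mem_ball.mp hy).le
    have := padicAlpha_add p x (y - x)
    rwa [add_sub_cancel, padicAlpha_eq_one p _ h, mul_one] at this
  exact continuousAt_const.congr this.symm

/-- The standard identification of `ℚ_p` with its Pontryagin dual: `y ↦ α_y`, `α_y(x) = α(y x)`. -/
def padicToDual (p : ℕ) [Fact p.Prime] (y : ℚ_[p]) : AddDual ℚ_[p] :=
  ({ toFun := fun x => padicAlpha p (y * x.toAdd)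
     map_one' := by
       rw [toAdd_one, mul_zero]
       exact padicAlpha_eq_one p 0 (by simp)
     map_mul' := fun a b => by rw [toAdd_mul, mul_add, padicAlpha_add]
     continuous_toFun := (continuous_padicAlpha p).comp
       (continuous_const.mul continuous_toAdd) } :
    Multiplicative ℚ_[p] →ₜ* Circle)

end PadicExample

end

/-! The arithmetic input is ℤ[1/p] + p^k ℤ_p = ℚ_p and ℤ[1/p] ∩ p^k ℤ_p = p^k ℤ. It makes p^k ℤ_p ×
[0, p^k) a fundamental domain of Γ for every k. The Haar measure of the box with k = 0 descends to
an invariant probability on the compact group Ω. It is the only one (`eq_solenoidMeasure`): the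
ℚ_p-orbit of 0 is dense, so a ℚ_p-invariant probability is invariant under all of Ω, hence Haar.

Unfolding sums over Γ into integrals over ℚ_p × ℝ (`lintegral_solenoidMeasure`) gives the moments.
The intensity is |W| = 1, and the autocorrelation is η⁺ = Σ_γ Λ(γ) δ_γ with Λ(x) = |W ∩ (W - x)| =
max(0, 1 - |x|).

The diffraction exists by the Poisson formula Σ_q Λ̂(q) |f̂(α_q)|² = η⁺(f * f*), q ∈ ℤ[1/p], Λ̂(ξ) =
(sin(πξ)/(πξ))² (`hasSum_triangleHat_normSq_dualFourier`). Classical Poisson summation on cosets of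
p^k ℤ identifies the partial sum over p^(-k) ℤ with the value of η⁺ on f * f* averaged over balls of
radius p^(-k). As k → ∞ the averages converge, and nonnegativity of the terms turns the limit of
partial sums into an unconditional sum. The term q = 0 is i² m(f * f*), so removing that atom
centers the measure.

Vanishing needs only one test function and therefore holds for every ν that satisfies the
definition, without uniqueness of the Fourier transform (`IsCenteredDiffraction.dualNhds_eq_zero`).
For f = 1_{ℤ_p} one has f * f* = f, and η(f) = Σ_{n ∈ ℤ} Λ(n) - 1 = 0 because Λ vanishes at the
nonzero integers. Hence ν(|f̂|²) = 0, while |f̂| ≥ 1/2 on an open set of characters that contains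
α_y for all y ∈ ℤ_p. -/

noncomputable section

/-! ### The lattice ℤ[1/p] in ℚ_p × ℝ and its fundamental domains -/

section Lattice

variable (p : ℕ) [hp : Fact p.Prime]

instance padicHaar.instIsAddHaarMeasure : (padicHaar p).IsAddHaarMeasure := by
  unfold padicHaar
  infer_instance

theorem padicHaar_unitBall : padicHaar p (padicUnitBall p) = 1 :=
  Measure.addHaarMeasure_self (K₀ := padicUnitCompact p)

theorem mem_padicLattice {z : ℚ_[p] × ℝ} :
    z ∈ padicLattice p ↔ ∃ q ∈ intInvP p, ((q : ℚ_[p]), (q : ℝ)) = z :=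
  Iff.rfl

/-- The parametrization of the lattice by `ℤ[1/p]`. -/
def latticeEquiv : intInvP p ≃ padicLattice p :=
  Equiv.ofBijective
    (fun q => ⟨(((q : ℚ) : ℚ_[p]), ((q : ℚ) : ℝ)), (mem_padicLattice p).2 ⟨q, q.2, rfl⟩⟩) <| by
    constructor
    · intro q r h
      have : ((q : ℚ) : ℝ) = ((r : ℚ) : ℝ) := congrArg (fun γ : padicLattice p => γ.1.2) h
      exact Subtype.ext (Rat.cast_injective this)
    · rintro ⟨_, q, hq, rfl⟩
      exact ⟨⟨q, hq⟩, rfl⟩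

@[simp]
theorem latticeEquiv_fst (q : intInvP p) :
    (latticeEquiv p q : ℚ_[p] × ℝ).1 = ((q : ℚ) : ℚ_[p]) :=
  rfl

@[simp]
theorem latticeEquiv_snd (q : intInvP p) :
    (latticeEquiv p q : ℚ_[p] × ℝ).2 = ((q : ℚ) : ℝ) :=
  rfl

instance intInvP.instCountable : Countable (intInvP p) :=
  inferInstanceAs (Countable {q : ℚ // q ∈ intInvP p})

instance padicLattice.instCountable : Countable (padicLattice p) :=
  (latticeEquiv p).symm.injective.countable

theorem intCast_mem_intInvP (k : ℤ) : (k : ℚ) ∈ intInvP p :=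
  ⟨k, 0, by simp⟩

theorem intCast_div_pow_mem_intInvP (k : ℤ) (n : ℕ) : (k : ℚ) / (p : ℚ) ^ n ∈ intInvP p :=
  ⟨k, n, rfl⟩

theorem mul_mem_intInvP {q r : ℚ} (hq : q ∈ intInvP p) (hr : r ∈ intInvP p) :
    q * r ∈ intInvP p := by
  obtain ⟨k, n, rfl⟩ := hq
  obtain ⟨l, m, rfl⟩ := hr
  exact ⟨k * l, n + m, by push_cast; rw [pow_add, div_mul_div_comm]⟩

theorem pow_mem_intInvP (k : ℕ) : (p : ℚ) ^ k ∈ intInvP p :=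
  ⟨(p : ℤ) ^ k, 0, by simp⟩

theorem norm_pow_p (k : ℕ) : ‖(p : ℚ_[p]) ^ k‖ = ((p : ℝ) ^ k)⁻¹ := by
  rw [norm_pow, Padic.norm_p, inv_pow]

theorem cast_p_pow_pos (k : ℕ) : (0 : ℝ) < (p : ℝ) ^ k :=
  pow_pos (Nat.cast_pos.2 hp.out.pos) k

/-- Approximation of `p`-adic numbers by elements of `ℤ[1/p]` up to `p ^ k ℤ_p`. -/
theorem exists_mem_intInvP_norm_sub_le (x : ℚ_[p]) (k : ℕ) :
    ∃ r ∈ intInvP p, ‖x - (r : ℚ_[p])‖ ≤ ((p : ℝ) ^ k)⁻¹ := by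
  have hpp : (p : ℚ_[p]) ≠ 0 := Nat.cast_ne_zero.mpr hp.out.ne_zero
  obtain ⟨r, hr, h⟩ := exists_padicFract p (x / (p : ℚ_[p]) ^ k)
  refine ⟨(p : ℚ) ^ k * r, mul_mem_intInvP p (pow_mem_intInvP p k) hr, ?_⟩
  have : x - (((p : ℚ) ^ k * r : ℚ) : ℚ_[p]) =
      (p : ℚ_[p]) ^ k * (x / (p : ℚ_[p]) ^ k - r) := by
    push_cast
    field_simp
  rw [this, norm_mul, norm_pow_p]
  exact mul_le_of_le_one_right (inv_nonneg.2 (cast_p_pow_pos p k).le) h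

/-- `ℤ[1/p] ∩ p ^ k ℤ_p = p ^ k ℤ`. -/
theorem norm_le_inv_pow_iff {r : ℚ} (hr : r ∈ intInvP p) (k : ℕ) :
    ‖(r : ℚ_[p])‖ ≤ ((p : ℝ) ^ k)⁻¹ ↔ ∃ l : ℤ, r = (p : ℚ) ^ k * l := by
  have hpq : (p : ℚ) ≠ 0 := Nat.cast_ne_zero.mpr hp.out.ne_zero
  constructor
  · intro h
    obtain ⟨l, hl⟩ := exists_int_of_norm_le_one p
      (r := r * ((1 : ℤ) / (p : ℚ) ^ k)) (mul_mem_intInvP p hr (intCast_div_pow_mem_intInvP p 1 k))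
      (by
        push_cast
        rw [norm_mul, norm_div, norm_one, norm_pow_p, one_div, inv_inv]
        calc _ ≤ ((p : ℝ) ^ k)⁻¹ * (p : ℝ) ^ k :=
              mul_le_mul_of_nonneg_right h (cast_p_pow_pos p k).le
          _ = 1 := inv_mul_cancel₀ (cast_p_pow_pos p k).ne')
    refine ⟨l, ?_⟩
    rw [← hl]
    push_cast
    field_simp
  · rintro ⟨l, rfl⟩
    push_cast
    rw [norm_mul, norm_pow_p]
    exact mul_le_of_le_one_right (inv_nonneg.2 (cast_p_pow_pos p k).le) (Padic.norm_int_le_one l)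

/-- `ℤ[1/p] ∩ p ^ (-k) ℤ_p = p ^ (-k) ℤ`. -/
theorem norm_le_pow_iff {r : ℚ} (hr : r ∈ intInvP p) (k : ℕ) :
    ‖(r : ℚ_[p])‖ ≤ (p : ℝ) ^ k ↔ ∃ l : ℤ, r = l / (p : ℚ) ^ k := by
  have hpq : (p : ℚ) ≠ 0 := Nat.cast_ne_zero.mpr hp.out.ne_zero
  constructor
  · intro h
    obtain ⟨l, hl⟩ := exists_int_of_norm_le_one p
      (r := (p : ℚ) ^ k * r) (mul_mem_intInvP p (pow_mem_intInvP p k) hr)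
      (by
        push_cast
        rw [norm_mul, norm_pow_p]
        calc _ ≤ ((p : ℝ) ^ k)⁻¹ * (p : ℝ) ^ k :=
              mul_le_mul_of_nonneg_left h (inv_nonneg.2 (cast_p_pow_pos p k).le)
          _ = 1 := inv_mul_cancel₀ (cast_p_pow_pos p k).ne')
    refine ⟨l, ?_⟩
    rw [← hl]
    field_simp
  · rintro ⟨l, rfl⟩
    push_cast
    rw [norm_div, norm_pow_p, div_inv_eq_mul]
    exact mul_le_of_le_one_left (cast_p_pow_pos p k).le (Padic.norm_int_le_one l)

theorem exists_le_cast_pow (R : ℝ) : ∃ k : ℕ, R ≤ (p : ℝ) ^ k := by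
  obtain ⟨k, hk⟩ := pow_unbounded_of_one_lt R (show (1 : ℝ) < p from mod_cast hp.out.one_lt)
  exact ⟨k, hk.le⟩

/-- The p-adic bound limits the denominator to p^k, and the real bound then limits the numerator.
All local finiteness below comes from here. -/
theorem finite_intInvP_inter (R C : ℝ) :
    {q : intInvP p | ‖((q : ℚ) : ℚ_[p])‖ ≤ R ∧ |((q : ℚ) : ℝ)| ≤ C}.Finite := by
  obtain ⟨k, hk⟩ := exists_le_cast_pow p R
  have hfin : (Set.Icc (-⌈C * (p : ℝ) ^ k⌉) ⌈C * (p : ℝ) ^ k⌉).Finite := Set.finite_Icc _ _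
  refine (hfin.image
    (fun l : ℤ => (⟨_, intCast_div_pow_mem_intInvP p l k⟩ : intInvP p))).subset ?_
  rintro ⟨q, hq⟩ ⟨h1, h2⟩
  obtain ⟨l, rfl⟩ := (norm_le_pow_iff p hq k).1 (h1.trans hk)
  refine ⟨l, ?_, rfl⟩
  have h3 : |(l : ℝ)| ≤ C * (p : ℝ) ^ k := by
    have : |(l : ℝ) / (p : ℝ) ^ k| ≤ C := by simpa using h2
    rwa [abs_div, abs_of_pos (cast_p_pow_pos p k), div_le_iff₀ (cast_p_pow_pos p k)] at this
  have h4 := abs_le.1 (h3.trans (Int.le_ceil _))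
  constructor
  · exact_mod_cast h4.1
  · exact_mod_cast h4.2

theorem finite_padicLattice_inter (R C : ℝ) :
    {γ : padicLattice p | ‖(γ : ℚ_[p] × ℝ).1‖ ≤ R ∧ |(γ : ℚ_[p] × ℝ).2| ≤ C}.Finite := by
  refine ((finite_intInvP_inter p R C).image (latticeEquiv p)).subset ?_
  intro γ hγ
  obtain ⟨q, rfl⟩ := (latticeEquiv p).surjective γ
  exact ⟨q, hγ, rfl⟩

theorem fst_injective_padicLattice :
    Function.Injective (fun γ : padicLattice p => (γ : ℚ_[p] × ℝ).1) := by
  intro γ γ' h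
  obtain ⟨q, rfl⟩ := (latticeEquiv p).surjective γ
  obtain ⟨r, rfl⟩ := (latticeEquiv p).surjective γ'
  have : ((q : ℚ) : ℚ_[p]) = ((r : ℚ) : ℚ_[p]) := h
  rw [Subtype.ext (Rat.cast_injective this)]

instance padicLattice.instDiscreteTopology : DiscreteTopology (padicLattice p) := by
  refine discreteTopology_of_isOpen_singleton_zero ?_
  have : ({0} : Set (padicLattice p)) =
      Subtype.val ⁻¹' (Metric.ball (0 : ℚ_[p]) 1 ×ˢ Metric.ball (0 : ℝ) 1) := by
    ext γ
    constructor
    · rintro rfl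
      simp
    · rintro ⟨h1, h2⟩
      obtain ⟨⟨q, hq⟩, rfl⟩ := (latticeEquiv p).surjective γ
      obtain ⟨k, rfl⟩ := exists_int_of_norm_le_one p hq (mem_ball_zero_iff.1 h1).le
      have h3 : |(k : ℝ)| < 1 := by simpa using h2
      have h4 : k = 0 := Int.abs_lt_one_iff.1 (by exact_mod_cast h3)
      subst h4
      refine Set.mem_singleton_iff.2 (Subtype.ext (Prod.ext ?_ ?_)) <;> simp
  rw [this]
  exact (Metric.isOpen_ball.prod Metric.isOpen_ball).preimage continuous_subtype_val

instance padicLattice.instIsClosed : IsClosed (padicLattice p : Set (ℚ_[p] × ℝ)) :=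
  AddSubgroup.isClosed_of_discrete

theorem dense_snd_padicLattice : Dense (Prod.snd '' (padicLattice p : Set (ℚ_[p] × ℝ))) := by
  rw [Metric.dense_iff]
  intro x ε hε
  obtain ⟨k, hk⟩ := exists_le_cast_pow p (2 / ε)
  have hk' : ((p : ℝ) ^ k)⁻¹ < ε := by
    rw [inv_lt_comm₀ (cast_p_pow_pos p k) hε]
    refine lt_of_lt_of_le ?_ hk
    rw [inv_eq_one_div]
    gcongr
    norm_num
  -- Truncation of the base p expansion of x, with error below p^(-k).
  refine ⟨((((⌊x * (p : ℝ) ^ k⌋ : ℚ) / (p : ℚ) ^ k : ℚ)) : ℝ), ?_,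
    ⟨_, (mem_padicLattice p).2 ⟨_, intCast_div_pow_mem_intInvP p _ k, rfl⟩, rfl⟩⟩
  rw [Metric.mem_ball, Real.dist_eq, abs_sub_comm]
  have h0 := cast_p_pow_pos p k
  have : x - (((⌊x * (p : ℝ) ^ k⌋ : ℚ) / (p : ℚ) ^ k : ℚ) : ℝ) =
      Int.fract (x * (p : ℝ) ^ k) * ((p : ℝ) ^ k)⁻¹ := by
    push_cast
    rw [Int.fract]
    field_simp
  rw [this, abs_of_nonneg (mul_nonneg (Int.fract_nonneg _) (inv_nonneg.2 h0.le))]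
  exact (mul_le_of_le_one_left (inv_nonneg.2 h0.le) (Int.fract_lt_one _).le).trans_lt hk'

/-- The fundamental domain `p ^ k ℤ_p × [0, p ^ k)` of the lattice. -/
def latticeBox (k : ℕ) : Set (ℚ_[p] × ℝ) :=
  Metric.closedBall 0 ((p : ℝ) ^ k)⁻¹ ×ˢ Set.Ico 0 ((p : ℝ) ^ k)

theorem measurableSet_latticeBox (k : ℕ) : MeasurableSet (latticeBox p k) :=
  Metric.isClosed_closedBall.measurableSet.prod measurableSet_Ico

theorem exists_vadd_mem_latticeBox (k : ℕ) (z : ℚ_[p] × ℝ) :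
    ∃ γ : padicLattice p, γ +ᵥ z ∈ latticeBox p k := by
  have h0 := cast_p_pow_pos p k
  obtain ⟨r, hr, h⟩ := exists_mem_intInvP_norm_sub_le p z.1 k
  -- Subtracting r brings the p-adic coordinate into p^k ℤ_p. A further multiple of p^k leaves it
  -- there and corrects the real coordinate.
  let l : ℤ := ⌊(z.2 - r) / (p : ℝ) ^ k⌋
  have hl : (p : ℚ) ^ k * l ∈ intInvP p :=
    mul_mem_intInvP p (pow_mem_intInvP p k) (intCast_mem_intInvP p l)
  refine ⟨latticeEquiv p ⟨_, (intInvP p).neg_mem ((intInvP p).add_mem hr hl)⟩, ?_, ?_⟩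
  · have e : ((latticeEquiv p ⟨_, (intInvP p).neg_mem ((intInvP p).add_mem hr hl)⟩ +ᵥ z).1 :
        ℚ_[p]) = (z.1 - (r : ℚ_[p])) + -(((p : ℚ) ^ k * l : ℚ) : ℚ_[p]) := by
      rw [AddSubgroup.vadd_def, vadd_eq_add, Prod.fst_add, latticeEquiv_fst]
      push_cast
      ring
    rw [mem_closedBall_zero_iff, e]
    refine (Padic.nonarchimedean _ _).trans (max_le h ?_)
    rw [norm_neg]
    exact (norm_le_inv_pow_iff p hl k).2 ⟨l, rfl⟩
  · have e : ((latticeEquiv p ⟨_, (intInvP p).neg_mem ((intInvP p).add_mem hr hl)⟩ +ᵥ z).2 :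
        ℝ) = (p : ℝ) ^ k * Int.fract ((z.2 - r) / (p : ℝ) ^ k) := by
      rw [AddSubgroup.vadd_def, vadd_eq_add, Prod.snd_add, latticeEquiv_snd, Int.fract, mul_sub,
        mul_div_cancel₀ _ h0.ne']
      push_cast
      ring
    rw [e]
    exact ⟨mul_nonneg h0.le (Int.fract_nonneg _),
      mul_lt_of_lt_one_right h0 (Int.fract_lt_one _)⟩

/-- The difference of the two lattice elements lies in p^k ℤ by the p-adic coordinate and has
absolute value below p^k by the real one. -/
theorem eq_of_vadd_mem_latticeBox (k : ℕ) (z : ℚ_[p] × ℝ) {γ γ' : padicLattice p}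
    (h : γ +ᵥ z ∈ latticeBox p k) (h' : γ' +ᵥ z ∈ latticeBox p k) : γ = γ' := by
  have h0 := cast_p_pow_pos p k
  obtain ⟨⟨q, hq⟩, rfl⟩ := (latticeEquiv p).surjective γ
  obtain ⟨⟨r, hr⟩, rfl⟩ := (latticeEquiv p).surjective γ'
  have h1 : ‖(q : ℚ_[p]) + z.1‖ ≤ _ := mem_closedBall_zero_iff.1 h.1
  have h1' : ‖(r : ℚ_[p]) + z.1‖ ≤ _ := mem_closedBall_zero_iff.1 h'.1
  have h2 : (0 : ℝ) ≤ q + z.2 ∧ q + z.2 < (p : ℝ) ^ k := h.2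
  have h2' : (0 : ℝ) ≤ r + z.2 ∧ r + z.2 < (p : ℝ) ^ k := h'.2
  obtain ⟨l, hl⟩ := (norm_le_inv_pow_iff p ((intInvP p).sub_mem hq hr) k).1 (by
    have : ((q - r : ℚ) : ℚ_[p]) = (q + z.1) + -(r + z.1) := by
      push_cast
      ring
    rw [this]
    refine (Padic.nonarchimedean _ _).trans (max_le h1 ?_)
    rwa [norm_neg])
  have hl' : (q : ℝ) - r = (p : ℝ) ^ k * l := by exact_mod_cast congrArg (Rat.cast (K := ℝ)) hl
  have h3 : |(p : ℝ) ^ k * l| < (p : ℝ) ^ k := by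
    rw [← hl', abs_lt]
    constructor <;> linarith
  rw [abs_mul, abs_of_pos h0] at h3
  have h4 : |(l : ℝ)| < 1 := by
    by_contra! h5
    exact absurd h3 (not_lt.2 (le_mul_of_one_le_right h0.le h5))
  have h5 : l = 0 := Int.abs_lt_one_iff.1 (by exact_mod_cast h4)
  subst h5
  have : q = r := by
    rw [Int.cast_zero, mul_zero] at hl
    exact sub_eq_zero.1 hl
  subst this
  rfl

/-- The Haar measure on `ℚ_p × ℝ`. -/
abbrev padicRealHaar : Measure (ℚ_[p] × ℝ) :=
  (padicHaar p).prod volume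

theorem isAddFundamentalDomain_latticeBox (k : ℕ) :
    IsAddFundamentalDomain (padicLattice p) (latticeBox p k) (padicRealHaar p) := by
  refine IsAddFundamentalDomain.mk' (measurableSet_latticeBox p k).nullMeasurableSet fun z => ?_
  obtain ⟨γ, hγ⟩ := exists_vadd_mem_latticeBox p k z
  exact ⟨γ, hγ, fun γ' hγ' => eq_of_vadd_mem_latticeBox p k z hγ' hγ⟩

theorem padicRealHaar_latticeBox_zero : padicRealHaar p (latticeBox p 0) = 1 := by
  have h := padicHaar_unitBall p
  rw [padicUnitBall_eq] at h
  simp [latticeBox, Measure.prod_prod, h]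

/-- `m(p ^ k ℤ_p) = p ^ (-k)`. -/
theorem padicHaar_closedBall (k : ℕ) :
    padicHaar p (Metric.closedBall 0 ((p : ℝ) ^ k)⁻¹) = ENNReal.ofReal ((p : ℝ) ^ k)⁻¹ := by
  -- Any two fundamental domains have the same measure, so m(p^k ℤ_p) · p^k = 1.
  have h := (isAddFundamentalDomain_latticeBox p k).measure_eq
    (isAddFundamentalDomain_latticeBox p 0)
  rw [padicRealHaar_latticeBox_zero, latticeBox, Measure.prod_prod, Real.volume_Ico, sub_zero] at h
  rw [ENNReal.ofReal_inv_of_pos (cast_p_pow_pos p k)]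
  exact ENNReal.eq_inv_of_mul_eq_one_left h

end Lattice

/-! ### The invariant probability on the quotient and its uniqueness -/

section QuotientMeasure

variable (p : ℕ) [hp : Fact p.Prime]

/-- The compact group `(ℚ_p × ℝ) / ℤ[1/p]`. -/
abbrev Solenoid : Type :=
  (ℚ_[p] × ℝ) ⧸ padicLattice p

theorem Solenoid.measurable_mk :
    Measurable (QuotientAddGroup.mk : ℚ_[p] × ℝ → Solenoid p) :=
  measurable_quotient_mk''

theorem Solenoid.mk_vadd (γ : padicLattice p) (z : ℚ_[p] × ℝ) :
    (QuotientAddGroup.mk (γ +ᵥ z) : Solenoid p) = QuotientAddGroup.mk z := by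
  rw [AddSubgroup.vadd_def, vadd_eq_add, add_comm]
  exact QuotientAddGroup.mk_add_of_mem z γ.2

theorem Solenoid.exists_mk_eq (ω : Solenoid p) :
    ∃ z ∈ latticeBox p 0, (QuotientAddGroup.mk z : Solenoid p) = ω := by
  obtain ⟨z, rfl⟩ := QuotientAddGroup.mk_surjective ω
  obtain ⟨γ, hγ⟩ := exists_vadd_mem_latticeBox p 0 z
  exact ⟨_, hγ, Solenoid.mk_vadd p γ z⟩

instance Solenoid.instCompactSpace : CompactSpace (Solenoid p) := by
  refine ⟨?_⟩
  have hK : IsCompact (Metric.closedBall (0 : ℚ_[p]) 1 ×ˢ Set.Icc (0 : ℝ) 1) :=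
    (isCompact_closedBall _ _).prod isCompact_Icc
  have himage := hK.image (f := (QuotientAddGroup.mk : ℚ_[p] × ℝ → Solenoid p))
    QuotientAddGroup.continuous_mk
  refine himage.of_isClosed_subset isClosed_univ fun ω _ => ?_
  obtain ⟨z, ⟨h1, h2⟩, rfl⟩ := Solenoid.exists_mk_eq p ω
  refine ⟨z, ⟨by simpa using h1, ?_⟩, rfl⟩
  have : z.2 ∈ Set.Ico (0 : ℝ) 1 := by simpa using h2
  exact Set.Ico_subset_Icc_self this

instance Solenoid.instBorelSpace : BorelSpace (Solenoid p) :=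
  QuotientAddGroup.borelSpace

instance Solenoid.instT2Space : T2Space (Solenoid p) :=
  inferInstance

/-- The invariant probability measure on the quotient. -/
def solenoidMeasure : Measure (Solenoid p) :=
  ((padicRealHaar p).restrict (latticeBox p 0)).map QuotientAddGroup.mk

instance solenoidMeasure.instIsProbabilityMeasure : IsProbabilityMeasure (solenoidMeasure p) := by
  refine ⟨?_⟩
  rw [solenoidMeasure, Measure.map_apply (Solenoid.measurable_mk p) MeasurableSet.univ,
    Set.preimage_univ, Measure.restrict_apply_univ, padicRealHaar_latticeBox_zero]

/-- The unfolding formula. -/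
theorem lintegral_solenoidMeasure {φ : Solenoid p → ℝ≥0∞} (hφ : Measurable φ)
    {Ψ : ℚ_[p] × ℝ → ℝ≥0∞} (hΨ : Measurable Ψ)
    (h : ∀ z, φ (QuotientAddGroup.mk z) = ∑' γ : padicLattice p, Ψ (γ +ᵥ z)) :
    ∫⁻ ω, φ ω ∂(solenoidMeasure p) = ∫⁻ z, Ψ z ∂(padicRealHaar p) := by
  rw [solenoidMeasure, lintegral_map hφ (Solenoid.measurable_mk p),
    (isAddFundamentalDomain_latticeBox p 0).lintegral_eq_tsum'', ← lintegral_tsum]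
  · exact lintegral_congr h
  · exact fun γ => (hΨ.comp (measurable_const_vadd γ)).aemeasurable

instance solenoidMeasure.instIsAddLeftInvariant : (solenoidMeasure p).IsAddLeftInvariant := by
  refine ⟨fun s => ?_⟩
  obtain ⟨s, rfl⟩ := QuotientAddGroup.mk_surjective s
  ext A hA
  have hmk := Solenoid.measurable_mk p
  have hs : Measurable fun ω : Solenoid p => QuotientAddGroup.mk s + ω :=
    measurable_const_add _
  rw [Measure.map_apply hs hA, solenoidMeasure, Measure.map_apply hmk (hs hA),
    Measure.map_apply hmk hA, Measure.restrict_apply (hmk (hs hA)), Measure.restrict_apply (hmk hA)]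
  set B : Set (ℚ_[p] × ℝ) := QuotientAddGroup.mk ⁻¹' A with hB
  have hF := isAddFundamentalDomain_latticeBox p 0
  -- After translation by s, the claim compares the Γ-invariant set B on the box and on the
  -- translated box, which is again a fundamental domain.
  have e1 : QuotientAddGroup.mk ⁻¹' ((fun ω : Solenoid p => QuotientAddGroup.mk s + ω) ⁻¹' A) ∩
      latticeBox p 0 = (fun z => s + z) ⁻¹' (B ∩ (s +ᵥ latticeBox p 0)) := by
    ext z
    have : s + z ∈ s +ᵥ latticeBox p 0 ↔ z ∈ latticeBox p 0 := by
      rw [← vadd_eq_add, Set.vadd_mem_vadd_set_iff]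
    simp only [Set.mem_inter_iff, Set.mem_preimage, this, hB, QuotientAddGroup.mk_add]
  rw [e1, measure_preimage_add]
  refine (hF.vadd_of_comm s).measure_set_eq hF (hmk hA) fun γ => ?_
  ext z
  simp only [hB, Set.mem_preimage, Solenoid.mk_vadd]

/-- The group `ℚ_p` acts on the quotient by translations. -/
theorem vadd_eq_mk_add (t : ℚ_[p]) (ω : Solenoid p) :
    t +ᵥ ω = QuotientAddGroup.mk ((t, 0) : ℚ_[p] × ℝ) + ω := by
  obtain ⟨z, rfl⟩ := QuotientAddGroup.mk_surjective ω
  rfl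

theorem isInvariantProbability_solenoidMeasure :
    IsInvariantProbability ℚ_[p] (solenoidMeasure p) where
  prob := inferInstance
  invariant t := by
    simp only [vadd_eq_mk_add]
    exact measurePreserving_add_left _ _

theorem isLatticeIn_padicLattice : IsLatticeIn (padicLattice p) :=
  ⟨inferInstance, solenoidMeasure p, inferInstance, fun s => by
    have : (fun ω : Solenoid p => s +ᵥ ω) = fun ω => QuotientAddGroup.mk s + ω := by
      ext ω
      obtain ⟨z, rfl⟩ := QuotientAddGroup.mk_surjective ω
      rfl
    rw [this]
    exact measurePreserving_add_left _ _⟩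

theorem isCutAndProjectDatum_padicLattice :
    IsCutAndProjectDatum (padicLattice p) halfWindow where
  lattice := isLatticeIn_padicLattice p
  injective := fun z hz w hw h =>
    congrArg Subtype.val (@fst_injective_padicLattice p _ ⟨z, hz⟩ ⟨w, hw⟩ h)
  dense := dense_snd_padicLattice p
  compact := by
    rw [halfWindow, isClosed_Icc.closure_eq]
    exact isCompact_Icc
  interior_nonempty := by
    rw [halfWindow, interior_Icc]
    exact ⟨0, by norm_num, by norm_num⟩
  interior_dense := by
    rw [halfWindow, interior_Icc, closure_Ioo (by norm_num)]

/-- Modulo Γ the point (t, γ₂) equals (t - γ₁, 0), so density of the projection of Γ to ℝ makes the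
ℚ_p-orbit of 0 dense. -/
theorem dense_range_mk_prod_zero :
    Dense (Set.range fun t : ℚ_[p] => (QuotientAddGroup.mk ((t, 0) : ℚ_[p] × ℝ) : Solenoid p)) := by
  have h1 : Dense (Set.univ ×ˢ (Prod.snd '' (padicLattice p : Set (ℚ_[p] × ℝ))) :
      Set (ℚ_[p] × ℝ)) := dense_univ.prod (dense_snd_padicLattice p)
  refine (QuotientAddGroup.mk_surjective.denseRange.dense_image
    (QuotientAddGroup.continuous_mk (N := padicLattice p)) h1).mono ?_
  rintro _ ⟨⟨t, _⟩, ⟨-, ⟨γ, hγ, rfl⟩⟩, rfl⟩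
  refine ⟨t - γ.1, QuotientAddGroup.eq.2 ?_⟩
  have : -((t - γ.1, 0) : ℚ_[p] × ℝ) + (t, γ.2) = γ := by
    ext <;> simp
  rwa [this]

/-- The `ℚ_p`-action on the quotient is uniquely ergodic. -/
theorem eq_solenoidMeasure {P : Measure (Solenoid p)} (hP : IsInvariantProbability ℚ_[p] P) :
    P = solenoidMeasure p := by
  have := hP.prob
  have hinv : ∀ s : Solenoid p, P.map (fun ω => s + ω) = P := by
    intro s
    have hm : Measurable fun ω : Solenoid p => s + ω := measurable_const_add s
    have : IsFiniteMeasure (P.map fun ω => s + ω) := Measure.isFiniteMeasure_map _ _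
    refine ext_of_forall_integral_eq_of_IsFiniteMeasure fun f => ?_
    rw [integral_map hm.aemeasurable f.continuous.aestronglyMeasurable]
    -- This continuous function is constant on the dense orbit, hence everywhere. Thus P is
    -- invariant under the whole compact group, and uniqueness of Haar measure applies.
    have hcont : Continuous fun s => ∫ ω, f (s + ω) ∂P := by
      refine continuous_of_dominated (bound := fun _ => ‖f‖) ?_ ?_ ?_ ?_
      · intro s
        exact (f.continuous.comp (continuous_const.add continuous_id)).aestronglyMeasurable
      · exact fun s => Filter.Eventually.of_forall fun ω => f.norm_coe_le_norm _
      · exact integrable_const _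
      · exact Filter.Eventually.of_forall fun ω =>
          f.continuous.comp (continuous_id.add continuous_const)
    refine congrFun (hcont.ext_on (dense_range_mk_prod_zero p)
      (continuous_const (y := ∫ ω, f ω ∂P)) ?_) s
    rintro _ ⟨t, rfl⟩
    have h := hP.invariant t
    simp only [vadd_eq_mk_add] at h
    exact (integral_map h.measurable.aemeasurable f.continuous.aestronglyMeasurable).symm.trans
      (by rw [h.map_eq])
  have hleft : P.IsAddLeftInvariant := ⟨hinv⟩
  have h1 : P.IsAddHaarMeasure :=
    Measure.isAddHaarMeasure_of_isCompact_nonempty_interior P Set.univ isCompact_univ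
      (by simp) (by simp) (by simp)
  have h2 : (solenoidMeasure p).IsAddHaarMeasure :=
    Measure.isAddHaarMeasure_of_isCompact_nonempty_interior _ Set.univ isCompact_univ
      (by simp) (by simp) (by simp)
  exact Measure.isAddHaarMeasure_eq_of_isProbabilityMeasure _ _

end QuotientMeasure

/-! ### The process: regularity, equivariance and local bounds -/

section RandomSet

variable (p : ℕ) [hp : Fact p.Prime]

/-- The cut-and-project process with window `[-1/2, 1/2]`. -/
abbrev padicProcess : Solenoid p → Measure ℚ_[p] :=
  cutAndProjectProcess (padicLattice p) halfWindow

/-- The indicator function of the window. -/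
def windowInd : ℝ → ℝ≥0∞ :=
  halfWindow.indicator 1

theorem measurable_windowInd : Measurable windowInd :=
  measurable_one.indicator measurableSet_Icc

/-- Shifting the window by -h and the result by g amounts to moving Γ by z = (g, h). In this form
the process is a sum over the Γ-orbit of z, as unfolding requires. -/
theorem randomCutAndProjectSet_mk (z : ℚ_[p] × ℝ) :
    randomCutAndProjectSet (padicLattice p) halfWindow (QuotientAddGroup.mk z) =
      (fun γ : padicLattice p => (γ +ᵥ z).1) '' {γ | (γ +ᵥ z).2 ∈ halfWindow} := by
  ext x
  constructor
  · rintro ⟨_, ⟨γ, ⟨hγ, -, w, hw, hwγ⟩, rfl⟩, rfl⟩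
    refine ⟨⟨γ, hγ⟩, ?_, rfl⟩
    have h : w - z.2 = γ.2 := hwγ
    have : (γ + z).2 = w := by rw [Prod.snd_add, ← h, sub_add_cancel]
    simpa only [Set.mem_ofPred_eq, AddSubgroup.vadd_def, vadd_eq_add, this] using hw
  · rintro ⟨γ, hγ, rfl⟩
    exact ⟨_, ⟨γ, ⟨γ.2, Set.mem_univ _, _, hγ, add_sub_cancel_right _ _⟩, rfl⟩, rfl⟩

theorem vadd_fst_injective (z : ℚ_[p] × ℝ) :
    Function.Injective fun γ : padicLattice p => (γ +ᵥ z).1 := fun _ _ h =>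
  fst_injective_padicLattice p (add_right_cancel (b := z.1) h)

theorem lintegral_padicProcess_mk (z : ℚ_[p] × ℝ) {f : ℚ_[p] → ℝ≥0∞} (hf : Measurable f) :
    ∫⁻ x, f x ∂(padicProcess p (QuotientAddGroup.mk z)) =
      ∑' γ : padicLattice p, windowInd (γ +ᵥ z).2 * f (γ +ᵥ z).1 := by
  rw [padicProcess, cutAndProjectProcess, diracComb, lintegral_sum_measure,
    randomCutAndProjectSet_mk]
  simp only [lintegral_dirac' _ hf]
  -- Injectivity of the projection to ℚ_p excludes multiplicities, so the sum over points is a sum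
  -- over lattice elements.
  rw [tsum_image f (vadd_fst_injective p z).injOn,
    tsum_subtype {γ : padicLattice p | (γ +ᵥ z).2 ∈ halfWindow} (fun γ => f (γ +ᵥ z).1)]
  refine tsum_congr fun γ => ?_
  by_cases h : (γ +ᵥ z).2 ∈ halfWindow <;> simp [windowInd, h]

theorem padicProcess_mk_apply (z : ℚ_[p] × ℝ) {A : Set ℚ_[p]} (hA : MeasurableSet A) :
    padicProcess p (QuotientAddGroup.mk z) A =
      ∑' γ : padicLattice p, windowInd (γ +ᵥ z).2 * A.indicator 1 (γ +ᵥ z).1 := by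
  rw [← lintegral_padicProcess_mk p z (measurable_one.indicator hA), lintegral_indicator_one hA]

theorem measurable_of_comp_mk {α : Type*} [MeasurableSpace α] {φ : Solenoid p → α}
    (h : Measurable fun z : ℚ_[p] × ℝ => φ (QuotientAddGroup.mk z)) : Measurable φ :=
  measurable_from_quotient.2 h

theorem measurable_padicProcess : Measurable (padicProcess p) := by
  refine Measure.measurable_of_measurable_coe _ fun A hA => measurable_of_comp_mk p ?_
  simp only [padicProcess_mk_apply p _ hA]
  refine Measurable.tsum fun γ => ?_
  exact (measurable_windowInd.comp (measurable_snd.comp (measurable_const_vadd γ))).mul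
    ((measurable_one.indicator hA).comp (measurable_fst.comp (measurable_const_vadd γ)))

/-- Uniformity in z is the point: one finite set of lattice elements serves the whole fundamental
domain, so point counts in bounded sets are bounded over all ω. -/
theorem finite_window_inter (R : ℝ) :
    ∃ T : Finset (padicLattice p), ∀ z ∈ latticeBox p 0, ∀ γ : padicLattice p,
      (γ +ᵥ z).1 ∈ Metric.closedBall (0 : ℚ_[p]) R → (γ +ᵥ z).2 ∈ halfWindow → γ ∈ T := by
  -- Here ‖z.1‖ ≤ 1 gives the bound max R 1 by the ultrametric inequality, and z.2 ∈ [0, 1) puts γ.2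
  -- in [-3/2, 1/2].
  refine ⟨(finite_padicLattice_inter p (max R 1) 2).toFinset, ?_⟩
  intro z hz γ h1 h2
  rw [Set.Finite.mem_toFinset]
  obtain ⟨hz1, hz2⟩ := hz
  simp only [pow_zero, inv_one, Set.mem_Ico, mem_closedBall_zero_iff] at hz1 hz2
  rw [mem_closedBall_zero_iff] at h1
  constructor
  · have e : (γ : ℚ_[p] × ℝ).1 = (γ +ᵥ z).1 + -z.1 := by
      simp [AddSubgroup.vadd_def]
    rw [e]
    refine (Padic.nonarchimedean _ _).trans (max_le_max h1 ?_)
    rwa [norm_neg]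
  · have e : (γ +ᵥ z).2 = (γ : ℚ_[p] × ℝ).2 + z.2 := rfl
    rw [halfWindow, Set.mem_Icc, e] at h2
    rw [abs_le]
    constructor <;> linarith

theorem exists_padicProcess_closedBall_le (R : ℝ) :
    ∃ C : ℕ, ∀ ω, padicProcess p ω (Metric.closedBall 0 R) ≤ C := by
  obtain ⟨T, hT⟩ := finite_window_inter p R
  refine ⟨T.card, fun ω => ?_⟩
  obtain ⟨z, hz, rfl⟩ := Solenoid.exists_mk_eq p ω
  rw [padicProcess_mk_apply p z Metric.isClosed_closedBall.measurableSet, tsum_eq_sum (s := T)]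
  · calc _ ≤ ∑ γ ∈ T, (1 : ℝ≥0∞) := by
          refine Finset.sum_le_sum fun γ _ => mul_le_one' ?_ ?_
          · exact Set.indicator_le_self' (fun _ _ => zero_le_one) _
          · exact Set.indicator_le_self' (fun _ _ => zero_le_one) _
      _ = _ := by simp
  · intro γ hγ
    by_contra h
    obtain ⟨h1, h2⟩ := mul_ne_zero_iff.1 h
    exact hγ (hT z hz γ (Set.mem_of_indicator_ne_zero h2) (Set.mem_of_indicator_ne_zero h1))

theorem exists_padicProcess_le {B : Set ℚ_[p]} (hB : Bornology.IsBounded B) :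
    ∃ C : ℕ, ∀ ω, padicProcess p ω B ≤ C := by
  obtain ⟨R, hR⟩ := hB.subset_closedBall 0
  obtain ⟨C, hC⟩ := exists_padicProcess_closedBall_le p R
  exact ⟨C, fun ω => (measure_mono hR).trans (hC ω)⟩

instance padicProcess.instIsFiniteMeasureOnCompacts (ω : Solenoid p) :
    IsFiniteMeasureOnCompacts (padicProcess p ω) := by
  refine ⟨fun K hK => ?_⟩
  obtain ⟨C, hC⟩ := exists_padicProcess_le p hK.isBounded
  exact (hC ω).trans_lt (ENNReal.natCast_lt_top C)

instance padicProcess.instSFinite (ω : Solenoid p) : SFinite (padicProcess p ω) := by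
  have : IsLocallyFiniteMeasure (padicProcess p ω) :=
    isLocallyFiniteMeasure_of_isFiniteMeasureOnCompacts
  infer_instance

theorem padicProcess_vadd (t : ℚ_[p]) (ω : Solenoid p) :
    padicProcess p (t +ᵥ ω) = (padicProcess p ω).map (fun x => t + x) := by
  obtain ⟨z, rfl⟩ := QuotientAddGroup.mk_surjective ω
  ext A hA
  have hm : Measurable fun x : ℚ_[p] => t + x := measurable_const_add t
  have e : t +ᵥ (QuotientAddGroup.mk z : Solenoid p) =
      QuotientAddGroup.mk ((t, 0) + z : ℚ_[p] × ℝ) := rfl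
  rw [Measure.map_apply hm hA, e, padicProcess_mk_apply p _ hA, padicProcess_mk_apply p _ (hm hA)]
  refine tsum_congr fun γ => ?_
  have e1 : (γ +ᵥ ((t, 0) + z)).1 = t + (γ +ᵥ z).1 := add_left_comm _ _ _
  have e2 : (γ +ᵥ ((t, 0) + z)).2 = (γ +ᵥ z).2 := by
    simp [AddSubgroup.vadd_def]
  rw [e1, e2]
  rfl

theorem isInvariantRandomMeasure_padicProcess :
    IsInvariantRandomMeasure (solenoidMeasure p) (padicProcess p) where
  invariantProbability := isInvariantProbability_solenoidMeasure p
  measurable := measurable_padicProcess p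
  radon _ := inferInstance
  equivariant := padicProcess_vadd p

theorem isSimplePointProcess_padicProcess :
    IsSimplePointProcess (solenoidMeasure p) (padicProcess p) := by
  refine Filter.Eventually.of_forall fun ω => ⟨_, fun K hK => ?_, rfl⟩
  obtain ⟨z, hz, rfl⟩ := Solenoid.exists_mk_eq p ω
  obtain ⟨R, hR⟩ := hK.isBounded.subset_closedBall 0
  obtain ⟨T, hT⟩ := finite_window_inter p R
  rw [randomCutAndProjectSet_mk]
  refine (T.finite_toSet.image fun γ : padicLattice p => (γ +ᵥ z).1).subset ?_
  rintro _ ⟨hxK, γ, hγ, rfl⟩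
  exact ⟨γ, hT z hz γ (hR hxK) hγ, rfl⟩

theorem isLocallySquareIntegrable_padicProcess :
    IsLocallySquareIntegrable (solenoidMeasure p) (padicProcess p) := by
  intro B _ hB
  obtain ⟨C, hC⟩ := exists_padicProcess_le p (hB.isBounded.subset subset_closure)
  calc _ ≤ ∫⁻ _, (C : ℝ≥0∞) ^ 2 ∂(solenoidMeasure p) :=
        lintegral_mono fun ω => pow_le_pow_left' (hC ω) 2
    _ < ∞ := by
        rw [lintegral_const, measure_univ, mul_one]
        exact ENNReal.pow_lt_top (ENNReal.natCast_lt_top C)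

/-! ### Intensity and autocorrelation by unfolding -/

theorem lintegral_windowInd : ∫⁻ x, windowInd x = 1 := by
  rw [windowInd, halfWindow, lintegral_indicator_one measurableSet_Icc, Real.volume_Icc]
  norm_num

theorem isIntensity_padicProcess :
    IsIntensity (padicHaar p) (solenoidMeasure p) (padicProcess p) 1 := by
  rw [IsIntensity, firstMoment, one_smul]
  ext A hA
  have hX := measurable_padicProcess p
  have hind : Measurable (A.indicator (1 : ℚ_[p] → ℝ≥0∞)) := measurable_one.indicator hA
  rw [Measure.bind_apply hA hX.aemeasurable,
    lintegral_solenoidMeasure p (φ := fun ω => padicProcess p ω A)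
      ((Measure.measurable_coe hA).comp hX)
      (Ψ := fun z => A.indicator 1 z.1 * windowInd z.2)
      ((hind.comp measurable_fst).mul (measurable_windowInd.comp measurable_snd))
      (fun z => by simp only [padicProcess_mk_apply p z hA, mul_comm]),
    lintegral_prod_mul hind.aemeasurable measurable_windowInd.aemeasurable, lintegral_windowInd,
    mul_one, lintegral_indicator_one hA]

/-- The triangle function `x ↦ max(0, 1 - |x|)`, which is the autocorrelation of the window. -/
def triangle (x : ℝ) : ℝ :=
  max 0 (1 - |x|)

theorem lintegral_windowInd_mul (x : ℝ) :
    ∫⁻ h, windowInd (x + h) * windowInd h = ENNReal.ofReal (triangle x) := by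
  -- The integrand is the indicator of W ∩ (W - x), an interval of length 1 - |x|, or empty when
  -- that number is negative.
  have : ∀ h, windowInd (x + h) * windowInd h =
      (Set.Icc (max (-1 / 2 - x) (-1 / 2)) (min (1 / 2 - x) (1 / 2))).indicator 1 h := by
    intro h
    have hiff : h ∈ Set.Icc (max (-1 / 2 - x) (-1 / 2)) (min (1 / 2 - x) (1 / 2)) ↔
        x + h ∈ halfWindow ∧ h ∈ halfWindow := by
      simp only [halfWindow, Set.mem_Icc, max_le_iff, le_min_iff]
      constructor
      · rintro ⟨⟨h1, h2⟩, h3, h4⟩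
        exact ⟨⟨by linarith, by linarith⟩, h2, h4⟩
      · rintro ⟨⟨h1, h2⟩, h3, h4⟩
        exact ⟨⟨by linarith, h3⟩, by linarith, h4⟩
    by_cases h1 : x + h ∈ halfWindow <;> by_cases h2 : h ∈ halfWindow <;>
      simp only [windowInd, Set.indicator, hiff, h1, h2, and_self, and_true, and_false, if_true,
        if_false, Pi.one_apply, mul_one, mul_zero]
  simp only [this]
  have hlen : min (1 / 2 - x) (1 / 2) - max (-1 / 2 - x) (-1 / 2) = 1 - |x| := by
    rcases le_total 0 x with hx | hx
    · rw [abs_of_nonneg hx, max_eq_right (by linarith), min_eq_left (by linarith)]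
      ring
    · rw [abs_of_nonpos hx, max_eq_left (by linarith), min_eq_right (by linarith)]
      ring
  rw [lintegral_indicator_one measurableSet_Icc, Real.volume_Icc, hlen, triangle]
  rcases le_total 0 (1 - |x|) with h | h
  · rw [max_eq_right h]
  · rw [max_eq_left h, ENNReal.ofReal_of_nonpos h, ENNReal.ofReal_zero]

/-- The autocorrelation `∑_γ max(0, 1 - |γ|) δ_γ` of the process. -/
def padicAutocorrelation : Measure ℚ_[p] :=
  Measure.sum fun γ : padicLattice p =>
    ENNReal.ofReal (triangle (γ : ℚ_[p] × ℝ).2) • Measure.dirac (γ : ℚ_[p] × ℝ).1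

theorem lintegral_padicAutocorrelation (f : ℚ_[p] → ℝ≥0∞) :
    ∫⁻ x, f x ∂(padicAutocorrelation p) =
      ∑' γ : padicLattice p,
        ENNReal.ofReal (triangle (γ : ℚ_[p] × ℝ).2) * f (γ : ℚ_[p] × ℝ).1 := by
  rw [padicAutocorrelation, lintegral_sum_measure]
  simp only [lintegral_smul_measure, lintegral_dirac, smul_eq_mul]

theorem triangle_eq_zero {x : ℝ} (h : 1 ≤ |x|) : triangle x = 0 :=
  max_eq_left (by linarith)

theorem triangle_nonneg (x : ℝ) : 0 ≤ triangle x :=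
  le_max_left _ _

theorem continuous_triangle : Continuous triangle := by
  unfold triangle
  fun_prop

instance padicAutocorrelation.instIsFiniteMeasureOnCompacts :
    IsFiniteMeasureOnCompacts (padicAutocorrelation p) := by
  refine ⟨fun K hK => ?_⟩
  obtain ⟨R, hR⟩ := hK.isBounded.subset_closedBall 0
  have hT := finite_padicLattice_inter p R 1
  rw [← lintegral_indicator_one hK.measurableSet, lintegral_padicAutocorrelation,
    tsum_eq_sum (s := hT.toFinset)]
  · refine ENNReal.sum_lt_top.2 fun γ _ => ENNReal.mul_lt_top ENNReal.ofReal_lt_top ?_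
    exact (Set.indicator_le_self' (fun _ _ => zero_le_one) _).trans_lt ENNReal.one_lt_top
  · intro γ hγ
    by_contra h
    obtain ⟨h1, h2⟩ := mul_ne_zero_iff.1 h
    refine hγ (hT.mem_toFinset.2 ⟨?_, ?_⟩)
    · exact mem_closedBall_zero_iff.1 (hR (Set.mem_of_indicator_ne_zero h2))
    · by_contra! h3
      exact h1 (by rw [triangle_eq_zero h3.le, ENNReal.ofReal_zero])

/-- Pairs of lattice elements are parametrized as (δ + γ, γ). The outer sum then runs over a single
function evaluated at γ + z, so the unfolding formula applies with δ as a parameter. -/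
theorem padicProcess_prod_mk_apply (z : ℚ_[p] × ℝ) {B : Set (ℚ_[p] × ℚ_[p])}
    (hB : MeasurableSet B) :
    ((padicProcess p (QuotientAddGroup.mk z)).prod (padicProcess p (QuotientAddGroup.mk z))) B =
      ∑' γ : padicLattice p, windowInd (γ +ᵥ z).2 * ∑' δ : padicLattice p,
        windowInd (δ +ᵥ γ +ᵥ z).2 * B.indicator 1 ((δ +ᵥ γ +ᵥ z).1, (γ +ᵥ z).1) := by
  rw [Measure.prod_apply_symm hB,
    lintegral_padicProcess_mk p z (measurable_measure_prodMk_right hB)]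
  refine tsum_congr fun γ => congrArg _ ?_
  rw [← Solenoid.mk_vadd p γ z, padicProcess_mk_apply p _ (measurable_prodMk_right hB)]
  rfl

theorem measurable_padicProcess_prod :
    Measurable fun ω => (padicProcess p ω).prod (padicProcess p ω) := by
  refine Measure.measurable_of_measurable_coe _ fun B hB => measurable_of_comp_mk p ?_
  simp only [padicProcess_prod_mk_apply p _ hB]
  have hind : Measurable (B.indicator (1 : ℚ_[p] × ℚ_[p] → ℝ≥0∞)) := measurable_one.indicator hB
  have hw := measurable_windowInd
  refine Measurable.tsum fun γ => Measurable.mul ?_ (Measurable.tsum fun δ => ?_)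
  · exact hw.comp (measurable_snd.comp (measurable_const_vadd γ))
  · have h1 : Measurable fun z : ℚ_[p] × ℝ => γ +ᵥ z := measurable_const_vadd γ
    have h2 : Measurable fun z : ℚ_[p] × ℝ => δ +ᵥ γ +ᵥ z := (measurable_const_vadd δ).comp h1
    exact (hw.comp h2.snd).mul (hind.comp (h2.fst.prodMk h1.fst))

theorem isAutocorrelation_padicProcess :
    IsAutocorrelation (padicHaar p) (solenoidMeasure p) (padicProcess p)
      (padicAutocorrelation p) where
  radon := inferInstance
  secondMoment_eq := by
    ext B hB
    have hind : Measurable (B.indicator (1 : ℚ_[p] × ℚ_[p] → ℝ≥0∞)) := measurable_one.indicator hB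
    have hw := measurable_windowInd
    have hmap : Measurable fun z : ℚ_[p] × ℚ_[p] => (z.1 + z.2, z.2) :=
      (measurable_fst.add measurable_snd).prodMk measurable_snd
    have hterm : ∀ δ : padicLattice p, Measurable fun z : ℚ_[p] × ℝ =>
        B.indicator (1 : ℚ_[p] × ℚ_[p] → ℝ≥0∞) ((δ : ℚ_[p] × ℝ).1 + z.1, z.1) *
          (windowInd ((δ : ℚ_[p] × ℝ).2 + z.2) * windowInd z.2) := fun δ =>
      (hind.comp ((measurable_fst.const_add _).prodMk measurable_fst)).mul
        ((hw.comp (measurable_snd.const_add _)).mul (hw.comp measurable_snd))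
    rw [secondMoment, Measure.bind_apply hB (measurable_padicProcess_prod p).aemeasurable,
      lintegral_solenoidMeasure p
        (φ := fun ω => ((padicProcess p ω).prod (padicProcess p ω)) B)
        ((Measure.measurable_coe hB).comp (measurable_padicProcess_prod p))
        (Measurable.tsum hterm)
        (fun z => by
          refine (padicProcess_prod_mk_apply p z hB).trans (tsum_congr fun γ => ?_)
          rw [← ENNReal.tsum_mul_left]
          refine tsum_congr fun δ => ?_
          exact (by intros; ring : ∀ a b c : ℝ≥0∞, a * (b * c) = c * (b * a)) _ _ _),
      lintegral_tsum fun δ => (hterm δ).aemeasurable, Measure.map_apply hmap hB,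
      Measure.prod_apply (hmap hB), lintegral_padicAutocorrelation]
    -- For fixed δ the unfolded integral factors: the real part is Λ(δ₂), and the p-adic part is the
    -- integral of 1_B(δ₁ + t, t) over t.
    refine tsum_congr fun δ => ?_
    rw [lintegral_prod_mul (f := fun t => B.indicator (1 : ℚ_[p] × ℚ_[p] → ℝ≥0∞)
        ((δ : ℚ_[p] × ℝ).1 + t, t))
        (g := fun h => windowInd ((δ : ℚ_[p] × ℝ).2 + h) * windowInd h)
        (hind.comp ((measurable_id.const_add _).prodMk measurable_id)).aemeasurable
        ((hw.comp (measurable_id.const_add _)).mul hw).aemeasurable,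
      lintegral_windowInd_mul, mul_comm]
    congr 1
    rw [← lintegral_indicator_one (measurable_prodMk_left (hmap hB))]
    rfl

end RandomSet

/-! ### The triangle function on ℝ: Fourier transform and Poisson summation -/

section TrianglePoisson

open scoped FourierTransform

/-- The Fourier transform `ξ ↦ (sin(πξ) / (πξ))²` of the triangle function. -/
def triangleHat (ξ : ℝ) : ℝ :=
  if ξ = 0 then 1 else 2 * (1 - Real.cos (2 * Real.pi * ξ)) / (2 * Real.pi * ξ) ^ 2

theorem triangleHat_nonneg (ξ : ℝ) : 0 ≤ triangleHat ξ := by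
  unfold triangleHat
  split_ifs
  · exact zero_le_one
  · have := Real.cos_le_one (2 * Real.pi * ξ)
    exact div_nonneg (by linarith) (sq_nonneg _)

theorem triangleHat_le {ξ : ℝ} (hξ : ξ ≠ 0) : triangleHat ξ ≤ 4 / (2 * Real.pi * ξ) ^ 2 := by
  rw [triangleHat, if_neg hξ]
  have := Real.neg_one_le_cos (2 * Real.pi * ξ)
  gcongr
  linarith

theorem integral_one_add_mul_exp {b : ℂ} (hb : b ≠ 0) :
    ∫ x : ℝ in (-1)..0, (1 + (x : ℂ)) * Complex.exp (b * x) =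
      1 / b - 1 / b ^ 2 + Complex.exp (-b) / b ^ 2 := by
  have hderiv : ∀ x : ℝ, HasDerivAt (fun y : ℝ => (1 + (y : ℂ)) * Complex.exp (b * y) / b -
      Complex.exp (b * y) / b ^ 2) ((1 + (x : ℂ)) * Complex.exp (b * x)) x := by
    intro x
    have h1 : HasDerivAt (fun y : ℝ => (y : ℂ)) 1 x := Complex.ofRealCLM.hasDerivAt
    have h2 : HasDerivAt (fun y : ℝ => Complex.exp (b * y)) (Complex.exp (b * x) * (b * 1)) x :=
      (h1.const_mul b).cexp
    refine ((((h1.const_add 1).mul h2).div_const b).sub (h2.div_const (b ^ 2))).congr_deriv ?_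
    field_simp
    ring
  rw [intervalIntegral.integral_eq_sub_of_hasDerivAt fun x _ => hderiv x]
  · simp
  · exact Continuous.intervalIntegrable (by fun_prop) _ _

theorem integral_one_sub_mul_exp {b : ℂ} (hb : b ≠ 0) :
    ∫ x : ℝ in (0)..1, (1 - (x : ℂ)) * Complex.exp (b * x) =
      Complex.exp b / b ^ 2 - 1 / b - 1 / b ^ 2 := by
  have hderiv : ∀ x : ℝ, HasDerivAt (fun y : ℝ => (1 - (y : ℂ)) * Complex.exp (b * y) / b +
      Complex.exp (b * y) / b ^ 2) ((1 - (x : ℂ)) * Complex.exp (b * x)) x := by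
    intro x
    have h1 : HasDerivAt (fun y : ℝ => (y : ℂ)) 1 x := Complex.ofRealCLM.hasDerivAt
    have h2 : HasDerivAt (fun y : ℝ => Complex.exp (b * y)) (Complex.exp (b * x) * (b * 1)) x :=
      (h1.const_mul b).cexp
    refine ((((h1.const_sub 1).mul h2).div_const b).add (h2.div_const (b ^ 2))).congr_deriv ?_
    field_simp
    ring
  rw [intervalIntegral.integral_eq_sub_of_hasDerivAt fun x _ => hderiv x]
  · simp
    ring
  · exact Continuous.intervalIntegrable (by fun_prop) _ _

theorem integral_triangle_mul (g : ℝ → ℂ) (hg : Continuous g) :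
    ∫ x, (triangle x : ℂ) * g x =
      (∫ x : ℝ in (-1)..0, (1 + (x : ℂ)) * g x) + ∫ x : ℝ in (0)..1, (1 - (x : ℂ)) * g x := by
  have hcont : Continuous fun x => (triangle x : ℂ) * g x :=
    (Complex.continuous_ofReal.comp continuous_triangle).mul hg
  rw [← intervalIntegral.integral_eq_integral_of_support_subset (a := -1) (b := 1),
    ← intervalIntegral.integral_add_adjacent_intervals (b := 0)
      (hcont.intervalIntegrable _ _) (hcont.intervalIntegrable _ _)]
  · congr 1
    · refine intervalIntegral.integral_congr fun x hx => ?_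
      rw [Set.uIcc_of_le (by norm_num)] at hx
      simp only [triangle]
      rw [abs_of_nonpos hx.2, max_eq_right (by linarith [hx.1])]
      push_cast
      ring
    · refine intervalIntegral.integral_congr fun x hx => ?_
      rw [Set.uIcc_of_le (by norm_num)] at hx
      simp only [triangle]
      rw [abs_of_nonneg hx.1, max_eq_right (by linarith [hx.2])]
      push_cast
      ring
  · intro x hx
    have : |x| < 1 := by
      by_contra! h
      exact hx (by simp [triangle_eq_zero h])
    exact ⟨(abs_lt.1 this).1, (abs_lt.1 this).2.le⟩

theorem fourier_triangle (ξ : ℝ) : 𝓕 (fun x => (triangle x : ℂ)) ξ = triangleHat ξ := by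
  rw [Real.fourier_real_eq_integral_exp_smul]
  set b : ℂ := -(2 * Real.pi * ξ * Complex.I) with hb
  have e : ∀ v : ℝ, Complex.exp (↑(-2 * Real.pi * v * ξ) * Complex.I) • (triangle v : ℂ) =
      (triangle v : ℂ) * Complex.exp (b * v) := by
    intro v
    rw [smul_eq_mul, mul_comm, hb]
    congr 2
    push_cast
    ring
  simp only [e]
  rw [integral_triangle_mul _ (by fun_prop)]
  by_cases hξ : ξ = 0
  · have hb0 : b = 0 := by simp [hb, hξ]
    have h1 : ∫ x : ℝ in (-1)..0, (1 + (x : ℂ)) * Complex.exp (b * x) = 1 / 2 := by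
      have : ∀ x : ℝ, (1 + (x : ℂ)) * Complex.exp (b * x) = ((1 + x : ℝ) : ℂ) := by
        intro x
        simp [hb0]
      simp only [this]
      rw [intervalIntegral.integral_ofReal, intervalIntegral.integral_add (by simp) (by simp)]
      norm_num
    have h2 : ∫ x : ℝ in (0)..1, (1 - (x : ℂ)) * Complex.exp (b * x) = 1 / 2 := by
      have : ∀ x : ℝ, (1 - (x : ℂ)) * Complex.exp (b * x) = ((1 - x : ℝ) : ℂ) := by
        intro x
        simp [hb0]
      simp only [this]
      rw [intervalIntegral.integral_ofReal, intervalIntegral.integral_sub (by simp) (by simp)]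
      norm_num
    rw [h1, h2, triangleHat, if_pos hξ]
    norm_num
  · have hpi : (Real.pi : ℂ) ≠ 0 := Complex.ofReal_ne_zero.2 Real.pi_ne_zero
    have hξ' : (ξ : ℂ) ≠ 0 := Complex.ofReal_ne_zero.2 hξ
    have hb0 : b ≠ 0 := by
      rw [hb, neg_ne_zero]
      exact mul_ne_zero (mul_ne_zero (mul_ne_zero two_ne_zero hpi) hξ') Complex.I_ne_zero
    have hb2 : b ^ 2 = -(2 * Real.pi * ξ) ^ 2 := by
      rw [hb, neg_sq, mul_pow, Complex.I_sq, mul_neg_one]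
    have hcos : Complex.exp b + Complex.exp (-b) = 2 * Complex.cos (2 * Real.pi * ξ) := by
      rw [Complex.two_cos, hb, neg_neg, add_comm, neg_mul]
    rw [integral_one_add_mul_exp hb0, integral_one_sub_mul_exp hb0, triangleHat, if_neg hξ]
    -- The terms ±1/b from the two halves of the triangle cancel.
    calc _ = (Complex.exp b + Complex.exp (-b) - 2) / b ^ 2 := by ring
      _ = _ := by
        rw [hcos, hb2]
        push_cast
        rw [div_neg, ← neg_div]
        congr 1
        ring

theorem summable_triangleHat {N : ℝ} (hN : 0 < N) :
    Summable fun j : ℤ => triangleHat (j / N) := by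
  have h1 : Summable fun j : ℤ => (if j = 0 then (1 : ℝ) else 0) :=
    (hasSum_ite_eq (0 : ℤ) (1 : ℝ)).summable
  have h2 : Summable fun j : ℤ => (N / Real.pi) ^ 2 * (1 / (j : ℝ) ^ 2) :=
    (Real.summable_one_div_int_pow.2 one_lt_two).mul_left _
  refine (h1.add h2).of_nonneg_of_le (fun j => triangleHat_nonneg _) fun j => ?_
  by_cases hj : j = 0
  · simp [hj, triangleHat]
  · have hj' : (j : ℝ) ≠ 0 := Int.cast_ne_zero.2 hj
    refine (triangleHat_le (div_ne_zero hj' hN.ne')).trans (le_of_eq ?_)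
    rw [if_neg hj, zero_add]
    field_simp
    norm_num

/-- Poisson summation for the triangle function on the lattice `r + Nℤ`. -/
theorem hasSum_triangleHat {N : ℝ} (hN : 0 < N) (r : ℝ) :
    HasSum (fun j : ℤ => (triangleHat (j / N) : ℂ) *
        Complex.exp (2 * Real.pi * Complex.I * j * (r / N)))
      (N * ∑' l : ℤ, (triangle (r + N * l) : ℂ)) := by
  have hN' : (N : ℂ) ≠ 0 := Complex.ofReal_ne_zero.2 hN.ne'
  have hsum : Summable fun j : ℤ => (triangleHat (j / N) : ℂ) *
      Complex.exp (2 * Real.pi * Complex.I * j * (r / N)) := by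
    refine (summable_triangleHat hN).of_norm_bounded fun j => ?_
    have : 2 * (Real.pi : ℂ) * Complex.I * j * (r / N) =
        ((2 * Real.pi * j * (r / N) : ℝ) : ℂ) * Complex.I := by
      push_cast
      ring
    rw [norm_mul, this, Complex.norm_exp_ofReal_mul_I, mul_one, Complex.norm_real,
      Real.norm_of_nonneg (triangleHat_nonneg _)]
  have hF : ∀ w : ℝ, 𝓕 (fun y => (triangle (N * y) : ℂ)) w = (N : ℂ)⁻¹ * triangleHat (w / N) := by
    intro w
    rw [← fourier_triangle, Real.fourier_real_eq_integral_exp_smul,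
      Real.fourier_real_eq_integral_exp_smul]
    have := Measure.integral_comp_mul_left (fun v : ℝ =>
      Complex.exp (↑(-2 * Real.pi * v * (w / N)) * Complex.I) • (triangle v : ℂ)) N
    rw [abs_of_pos (inv_pos.2 hN), Complex.real_smul, Complex.ofReal_inv] at this
    rw [← this]
    congr 1
    ext v
    congr 4
    field_simp
  -- Poisson summation over ℤ for y ↦ Λ(Ny), evaluated at r/N. The decay hypothesis is met because
  -- this function vanishes for |y| ≥ 1/N.
  have hP := Real.tsum_eq_tsum_fourier_of_rpow_decay_of_summable
    (f := fun y => (triangle (N * y) : ℂ))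
    (Complex.continuous_ofReal.comp (continuous_triangle.comp (continuous_const.mul continuous_id)))
    one_lt_two
    (by
      refine Filter.EventuallyEq.trans_isBigO ?_ (Asymptotics.isBigO_zero _ _)
      filter_upwards [(tendsto_norm_cocompact_atTop (E := ℝ)).eventually_ge_atTop N⁻¹] with y hy
      rw [triangle_eq_zero, Complex.ofReal_zero]
      rw [abs_mul, abs_of_pos hN]
      exact (inv_le_iff_one_le_mul₀' hN).1 hy)
    (by
      simp only [hF]
      exact (Complex.ofRealCLM.summable (summable_triangleHat hN)).mul_left _)
    (r / N)
  simp only [hF, fourier_coe_apply] at hP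
  have hP' : ∑' l : ℤ, (triangle (r + N * l) : ℂ) = (N : ℂ)⁻¹ * ∑' j : ℤ,
      (triangleHat (j / N) : ℂ) * Complex.exp (2 * Real.pi * Complex.I * j * (r / N)) := by
    rw [← tsum_mul_left]
    refine (tsum_congr fun l => ?_).trans (hP.trans (tsum_congr fun j => ?_))
    · congr 2
      field_simp
    · rw [mul_assoc]
      congr 3
      push_cast
      ring
  rw [hP', ← mul_assoc, mul_inv_cancel₀ hN', one_mul]
  exact hsum.hasSum

end TrianglePoisson

/-! ### Poisson summation over ℤ[1/p] in ℚ_p -/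

section PadicPoisson

open Filter Topology

theorem HasSum.of_eq {ι E : Type*} [AddCommMonoid E] [TopologicalSpace E] {f g : ι → E} {a b : E}
    (h : HasSum f a) (hfg : ∀ i, g i = f i) (hab : b = a) : HasSum g b := by
  rwa [funext hfg, hab]

variable (p : ℕ) [hp : Fact p.Prime]

theorem coe_padicToDual_apply (y x : ℚ_[p]) :
    padicToDual p y (Multiplicative.ofAdd x) = padicAlpha p (y * x) :=
  rfl

theorem padicToDual_zero : padicToDual p 0 = 1 := by
  ext x
  have : padicToDual p 0 x = padicAlpha p (0 * x.toAdd) := rfl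
  rw [this, zero_mul, padicAlpha_eq_one p 0 (by simp)]
  rfl

/-- Since (j / p^k)(x - r) ∈ ℤ_p, the p-adic character at x is determined by the rational number jr
/ p^k. This turns it into a real exponential, to which classical Poisson summation applies;
conjugation accounts for -r. -/
theorem star_padicAlpha_div_mul (k : ℕ) (j : ℤ) (x : ℚ_[p]) {r : ℚ} (hr : r ∈ intInvP p)
    (h : ‖x - (r : ℚ_[p])‖ ≤ ((p : ℝ) ^ k)⁻¹) :
    (starRingEnd ℂ) (padicAlpha p ((((j : ℚ) / (p : ℚ) ^ k : ℚ) : ℚ_[p]) * x) : ℂ) =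
      Complex.exp (2 * Real.pi * Complex.I * j * (((-r : ℚ) : ℝ) / ((p : ℝ) ^ k : ℝ))) := by
  have hj := intCast_div_pow_mem_intInvP p j k
  have h1 : ‖(((j : ℚ) / (p : ℚ) ^ k : ℚ) : ℚ_[p]) * x -
      (((j : ℚ) / (p : ℚ) ^ k * r : ℚ) : ℚ_[p])‖ ≤ 1 := by
    rw [Rat.cast_mul, ← mul_sub, norm_mul]
    calc _ ≤ (p : ℝ) ^ k * ((p : ℝ) ^ k)⁻¹ :=
          mul_le_mul ((norm_le_pow_iff p hj k).2 ⟨j, rfl⟩) h (norm_nonneg _)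
            (cast_p_pow_pos p k).le
      _ = 1 := mul_inv_cancel₀ (cast_p_pow_pos p k).ne'
  rw [padicAlpha_eq p _ _ (mul_mem_intInvP p hj hr) h1, Circle.coe_exp, ← Complex.exp_conj,
    map_mul, Complex.conj_I, Complex.conj_ofReal]
  congr 1
  push_cast
  ring

/-- Poisson summation over `p ^ (-k) ℤ`, seen from `ℚ_p`. -/
theorem hasSum_triangleHat_padicAlpha (k : ℕ) (x : ℚ_[p]) :
    HasSum (fun j : ℤ => (triangleHat (j / (p : ℝ) ^ k) : ℂ) *
        (starRingEnd ℂ) (padicAlpha p ((((j : ℚ) / (p : ℚ) ^ k : ℚ) : ℚ_[p]) * x) : ℂ))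
      (((p : ℝ) ^ k : ℝ) * ∑' q : intInvP p, if ‖x - ((q : ℚ) : ℚ_[p])‖ ≤ ((p : ℝ) ^ k)⁻¹ then
        (triangle (q : ℚ) : ℂ) else 0) := by
  obtain ⟨r, hr, h⟩ := exists_mem_intInvP_norm_sub_le p x k
  simp only [star_padicAlpha_div_mul p k _ x hr h]
  have hmem : ∀ l : ℤ, r - (p : ℚ) ^ k * l ∈ intInvP p := fun l =>
    (intInvP p).sub_mem hr (mul_mem_intInvP p (pow_mem_intInvP p k) (intCast_mem_intInvP p l))
  let φ : ℤ → intInvP p := fun l => ⟨r - (p : ℚ) ^ k * l, hmem l⟩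
  have hφ : Function.Injective φ := by
    intro l l' hl
    have h1 : r - (p : ℚ) ^ k * l = r - (p : ℚ) ^ k * l' := congrArg Subtype.val hl
    have h2 : ((p : ℚ) ^ k) ≠ 0 := pow_ne_zero _ (Nat.cast_ne_zero.mpr hp.out.ne_zero)
    exact_mod_cast mul_left_cancel₀ h2 (sub_right_injective h1)
  -- The elements of ℤ[1/p] that are p^(-k)-close to x form the coset r + p^k ℤ.
  have hcond : ∀ q : intInvP p, ‖x - ((q : ℚ) : ℚ_[p])‖ ≤ ((p : ℝ) ^ k)⁻¹ ↔ q ∈ Set.range φ := by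
    intro q
    have h1 : ‖x - ((q : ℚ) : ℚ_[p])‖ ≤ ((p : ℝ) ^ k)⁻¹ ↔
        ‖((r - q : ℚ) : ℚ_[p])‖ ≤ ((p : ℝ) ^ k)⁻¹ := by
      constructor
      · intro h2
        have : ((r - q : ℚ) : ℚ_[p]) = (x - (q : ℚ)) + -(x - r) := by
          push_cast
          ring
        rw [this]
        refine (Padic.nonarchimedean _ _).trans (max_le h2 ?_)
        rwa [norm_neg]
      · intro h2
        have : x - ((q : ℚ) : ℚ_[p]) = (x - r) + ((r - q : ℚ) : ℚ_[p]) := by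
          push_cast
          ring
        rw [this]
        exact (Padic.nonarchimedean _ _).trans (max_le h h2)
    rw [h1, norm_le_inv_pow_iff p ((intInvP p).sub_mem hr q.2) k]
    constructor
    · rintro ⟨l, hl⟩
      exact ⟨l, Subtype.ext (by simp only [φ]; linarith)⟩
    · rintro ⟨l, rfl⟩
      exact ⟨l, by simp only [φ]; ring⟩
  -- The real formula runs over -r + p^k ℤ; evenness of the triangle function converts it to r - p^k
  -- ℤ.
  convert hasSum_triangleHat (cast_p_pow_pos p k) ((-r : ℚ) : ℝ) using 2
  rw [← hφ.tsum_eq]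
  · refine tsum_congr fun l => ?_
    rw [if_pos ((hcond _).2 ⟨l, rfl⟩)]
    congr 1
    simp only [φ, triangle]
    rw [← abs_neg]
    congr 3
    push_cast
    ring
  · intro q hq
    by_contra h2
    exact hq (if_neg (mt (hcond q).1 h2))

/-- The pointwise formula is multiplied by g and integrated term by term, which is allowed because
Λ̂ is summable over p^(-k) ℤ and characters have modulus one. -/
theorem hasSum_triangleHat_dualFourier (k : ℕ) {g : ℚ_[p] → ℂ} (hg : Integrable g (padicHaar p)) :
    HasSum (fun j : ℤ => (triangleHat (j / (p : ℝ) ^ k) : ℂ) *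
        dualFourier (padicHaar p) g (padicToDual p (((j : ℚ) / (p : ℚ) ^ k : ℚ) : ℚ_[p])))
      (∫ x, g x * (((p : ℝ) ^ k : ℝ) * ∑' q : intInvP p,
        if ‖x - ((q : ℚ) : ℚ_[p])‖ ≤ ((p : ℝ) ^ k)⁻¹ then (triangle (q : ℚ) : ℂ) else 0)
          ∂(padicHaar p)) := by
  let F : ℤ → ℚ_[p] → ℂ := fun j x => g x * ((triangleHat (j / (p : ℝ) ^ k) : ℂ) *
    (starRingEnd ℂ) (padicAlpha p ((((j : ℚ) / (p : ℚ) ^ k : ℚ) : ℚ_[p]) * x) : ℂ))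
  have hnorm : ∀ j x, ‖F j x‖ = triangleHat (j / (p : ℝ) ^ k) * ‖g x‖ := by
    intro j x
    simp only [F]
    rw [norm_mul, norm_mul, RCLike.norm_conj, Circle.norm_coe, mul_one, Complex.norm_real,
      Real.norm_of_nonneg (triangleHat_nonneg _), mul_comm]
  have hcont : ∀ j : ℤ, Continuous fun x : ℚ_[p] =>
      (starRingEnd ℂ) (padicAlpha p ((((j : ℚ) / (p : ℚ) ^ k : ℚ) : ℚ_[p]) * x) : ℂ) := fun j =>
    Complex.continuous_conj.comp (continuous_subtype_val.comp
      ((continuous_padicAlpha p).comp (continuous_const_mul _)))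
  have hint : ∀ j, Integrable (F j) (padicHaar p) := by
    intro j
    refine Integrable.mono' (hg.norm.const_mul (triangleHat (j / (p : ℝ) ^ k))) ?_
      (Eventually.of_forall fun x => (hnorm j x).le)
    exact hg.aestronglyMeasurable.mul
      ((hcont j).aestronglyMeasurable.const_mul _)
  have hsum := hasSum_integral_of_summable_integral_norm hint (by
    simp only [hnorm, integral_const_mul]
    exact (summable_triangleHat (cast_p_pow_pos p k)).mul_right _)
  refine hsum.of_eq (fun j => ?_) ?_
  · simp only [dualFourier, F, coe_padicToDual_apply]
    rw [← integral_const_mul]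
    congr 1
    ext x
    ring
  · congr 1
    ext x
    rw [← (hasSum_triangleHat_padicAlpha p k x).tsum_eq, ← tsum_mul_left]

theorem padicHaar_closedBall_center (k : ℕ) (x : ℚ_[p]) :
    (padicHaar p).real (Metric.closedBall x ((p : ℝ) ^ k)⁻¹) = ((p : ℝ) ^ k)⁻¹ := by
  have : Metric.closedBall (0 : ℚ_[p]) ((p : ℝ) ^ k)⁻¹ =
      (fun y => x + y) ⁻¹' Metric.closedBall x ((p : ℝ) ^ k)⁻¹ := by
    ext y
    simp
  rw [Measure.real, ← measure_preimage_add (padicHaar p) x, ← this, padicHaar_closedBall,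
    ENNReal.toReal_ofReal (inv_nonneg.2 (cast_p_pow_pos p k).le)]

theorem tendsto_inv_cast_pow : Tendsto (fun k : ℕ => ((p : ℝ) ^ k)⁻¹) atTop (𝓝 0) :=
  tendsto_inv_atTop_zero.comp
    (tendsto_pow_atTop_atTop_of_one_lt (show (1 : ℝ) < p from mod_cast hp.out.one_lt))

/-- The averages of a continuous function over small balls converge to its value. -/
theorem tendsto_average_closedBall {g : ℚ_[p] → ℂ} (hg : Continuous g) (x : ℚ_[p]) :
    Tendsto (fun k : ℕ => (((p : ℝ) ^ k : ℝ) : ℂ) *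
      ∫ y in Metric.closedBall x ((p : ℝ) ^ k)⁻¹, g y ∂(padicHaar p)) atTop (𝓝 (g x)) := by
  rw [Metric.tendsto_nhds]
  intro ε hε
  obtain ⟨δ, hδ, h⟩ := Metric.continuous_iff.1 hg x (ε / 2) (half_pos hε)
  filter_upwards [(tendsto_inv_cast_pow p).eventually (gt_mem_nhds hδ)] with k hk
  have h0 := cast_p_pow_pos p k
  set B := Metric.closedBall x ((p : ℝ) ^ k)⁻¹ with hB
  have hm := padicHaar_closedBall_center p k x
  have hfin : padicHaar p B < ∞ := (isCompact_closedBall _ _).measure_lt_top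
  have hint : IntegrableOn g B (padicHaar p) :=
    hg.continuousOn.integrableOn_compact (isCompact_closedBall _ _)
  have e : (((p : ℝ) ^ k : ℝ) : ℂ) * ∫ y in B, g y ∂(padicHaar p) - g x =
      (((p : ℝ) ^ k : ℝ) : ℂ) * ∫ y in B, (g y - g x) ∂(padicHaar p) := by
    rw [integral_sub hint (integrableOn_const hfin.ne), setIntegral_const, hm, Complex.real_smul,
      mul_sub, ← mul_assoc, ← Complex.ofReal_mul, mul_inv_cancel₀ h0.ne', Complex.ofReal_one,
      one_mul]
  have hle : ‖∫ y in B, (g y - g x) ∂(padicHaar p)‖ ≤ ε / 2 * ((p : ℝ) ^ k)⁻¹ := by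
    rw [← hm]
    refine norm_setIntegral_le_of_norm_le_const hfin fun y hy => ?_
    rw [← dist_eq_norm]
    exact (h y ((Metric.mem_closedBall.1 hy).trans_lt hk)).le
  rw [dist_eq_norm, e, norm_mul, Complex.norm_real, Real.norm_of_nonneg h0.le]
  calc _ ≤ (p : ℝ) ^ k * (ε / 2 * ((p : ℝ) ^ k)⁻¹) := mul_le_mul_of_nonneg_left hle h0.le
    _ = ε / 2 := by field_simp
    _ < ε := half_lt_self hε

theorem integral_padicAutocorrelation {g : ℚ_[p] → ℂ} (hg : Continuous g)
    (hgs : HasCompactSupport g) :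
    HasSum (fun q : intInvP p => (triangle (q : ℚ) : ℂ) * g (q : ℚ))
      (∫ x, g x ∂(padicAutocorrelation p)) := by
  have hint : Integrable g (padicAutocorrelation p) := hg.integrable_of_hasCompactSupport hgs
  have := hasSum_integral_measure hint
  rw [← (latticeEquiv p).hasSum_iff] at this
  refine this.of_eq (fun q => ?_) rfl
  rw [Function.comp_apply, integral_smul_measure, integral_dirac,
    ENNReal.toReal_ofReal (triangle_nonneg _), Complex.real_smul]
  rfl

/-- The summation formula for `ℤ[1/p]`: the sums of `ĝ` against the transformed triangle over
`p ^ (-k) ℤ` converge to the integral of `g` against the autocorrelation. -/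
theorem tendsto_tsum_triangleHat_dualFourier {g : ℚ_[p] → ℂ} (hg : Continuous g)
    (hgs : HasCompactSupport g) :
    Tendsto (fun k : ℕ => ∑' j : ℤ, (triangleHat (j / (p : ℝ) ^ k) : ℂ) *
        dualFourier (padicHaar p) g (padicToDual p (((j : ℚ) / (p : ℚ) ^ k : ℚ) : ℚ_[p])))
      atTop (𝓝 (∫ x, g x ∂(padicAutocorrelation p))) := by
  have hint : Integrable g (padicHaar p) := hg.integrable_of_hasCompactSupport hgs
  obtain ⟨R, hR⟩ := hgs.isBounded.subset_closedBall 0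
  -- This finite set contains, for every k at once, all q with Λ(q) ≠ 0 whose ball of radius p^(-k)
  -- ≤ 1 meets the support of g. The limit k → ∞ thus involves only finitely many terms.
  have hfin := finite_intInvP_inter p (max R 1) 1
  set T := hfin.toFinset with hT
  have hgR : ∀ x, g x ≠ 0 → ‖x‖ ≤ R := fun x hx =>
    mem_closedBall_zero_iff.1 (hR (subset_tsupport g hx))
  have hnotT : ∀ q : intInvP p, q ∉ T → ‖((q : ℚ) : ℚ_[p])‖ ≤ max R 1 →
      triangle ((q : ℚ) : ℝ) = 0 := by
    intro q hq h1
    refine triangle_eq_zero ?_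
    by_contra! h2
    exact hq (hfin.mem_toFinset.2 ⟨h1, h2.le⟩)
  have hlim : ∫ x, g x ∂(padicAutocorrelation p) =
      ∑ q ∈ T, (triangle ((q : ℚ) : ℝ) : ℂ) * g ((q : ℚ) : ℚ_[p]) := by
    rw [← (integral_padicAutocorrelation p hg hgs).tsum_eq, tsum_eq_sum]
    intro q hq
    by_cases h : g ((q : ℚ) : ℚ_[p]) = 0
    · rw [h, mul_zero]
    · rw [hnotT q hq ((hgR _ h).trans (le_max_left _ _)), Complex.ofReal_zero, zero_mul]
  have hk : ∀ k : ℕ, ∑' j : ℤ, (triangleHat (j / (p : ℝ) ^ k) : ℂ) *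
        dualFourier (padicHaar p) g (padicToDual p (((j : ℚ) / (p : ℚ) ^ k : ℚ) : ℚ_[p])) =
      ∑ q ∈ T, (triangle ((q : ℚ) : ℝ) : ℂ) * ((((p : ℝ) ^ k : ℝ) : ℂ) *
        ∫ y in Metric.closedBall ((q : ℚ) : ℚ_[p]) ((p : ℝ) ^ k)⁻¹, g y ∂(padicHaar p)) := by
    intro k
    have hone : ((p : ℝ) ^ k)⁻¹ ≤ 1 :=
      inv_le_one_of_one_le₀ (one_le_pow₀ (mod_cast hp.out.one_le))
    rw [(hasSum_triangleHat_dualFourier p k hint).tsum_eq]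
    have hpoint : ∀ x, g x * ((((p : ℝ) ^ k : ℝ) : ℂ) * ∑' q : intInvP p,
        if ‖x - ((q : ℚ) : ℚ_[p])‖ ≤ ((p : ℝ) ^ k)⁻¹ then (triangle (q : ℚ) : ℂ) else 0) =
        ∑ q ∈ T, (triangle ((q : ℚ) : ℝ) : ℂ) * ((((p : ℝ) ^ k : ℝ) : ℂ) *
          (Metric.closedBall ((q : ℚ) : ℚ_[p]) ((p : ℝ) ^ k)⁻¹).indicator g x) := by
      intro x
      by_cases hx : g x = 0
      · rw [hx, zero_mul]
        refine (Finset.sum_eq_zero fun q _ => ?_).symm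
        rw [Set.indicator_apply_eq_zero.2 fun _ => hx, mul_zero, mul_zero]
      · rw [tsum_eq_sum (s := T), Finset.mul_sum, Finset.mul_sum]
        · refine Finset.sum_congr rfl fun q _ => ?_
          by_cases h : ‖x - ((q : ℚ) : ℚ_[p])‖ ≤ ((p : ℝ) ^ k)⁻¹
          · rw [if_pos h, Set.indicator_of_mem (mem_closedBall_iff_norm.2 h)]
            ring
          · rw [if_neg h, Set.indicator_of_notMem (mt mem_closedBall_iff_norm.1 h)]
            ring
        · intro q hq
          split_ifs with h
          · rw [hnotT q hq, Complex.ofReal_zero]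
            have e : ((q : ℚ) : ℚ_[p]) = x + -(x - (q : ℚ)) := by ring
            rw [e]
            refine (Padic.nonarchimedean _ _).trans (max_le_max (hgR x hx) ?_)
            rw [norm_neg]
            exact h.trans hone
          · rfl
    simp only [hpoint]
    rw [integral_finsetSum]
    · refine Finset.sum_congr rfl fun q _ => ?_
      rw [integral_const_mul, integral_const_mul,
        integral_indicator Metric.isClosed_closedBall.measurableSet]
    · exact fun q _ => ((hint.indicator Metric.isClosed_closedBall.measurableSet).const_mul
        _).const_mul _
  simp only [hk, hlim]
  exact tendsto_finsetSum _ fun q _ => (tendsto_average_closedBall p hg _).const_mul _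

/-- A nonnegative family on `ℤ[1/p]` is summable if its sums over `p ^ (-k) ℤ` converge. -/
theorem hasSum_intInvP_of_tendsto {a : intInvP p → ℝ} (ha : ∀ q, 0 ≤ a q) {t : ℕ → ℝ} {s : ℝ}
    (ht : ∀ k, HasSum (fun j : ℤ => a ⟨_, intCast_div_pow_mem_intInvP p j k⟩) (t k))
    (hs : Tendsto t atTop (𝓝 s)) : HasSum a s := by
  let φ : ℕ → ℤ → intInvP p := fun k j => ⟨_, intCast_div_pow_mem_intInvP p j k⟩
  have hφ : ∀ k, Function.Injective (φ k) := by
    intro k j j' h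
    have h1 : (j : ℚ) / (p : ℚ) ^ k = (j' : ℚ) / (p : ℚ) ^ k := congrArg Subtype.val h
    have h2 : ((p : ℚ) ^ k) ≠ 0 := pow_ne_zero _ (Nat.cast_ne_zero.mpr hp.out.ne_zero)
    exact_mod_cast (div_left_inj' h2).1 h1
  have hle : ∀ u : Finset (intInvP p), ∑ q ∈ u, a q ≤ s := by
    intro u
    -- The groups p^(-k) ℤ increase to ℤ[1/p], so a finite set is eventually contained in one of
    -- them and its sum is at most t k.
    have hu : ∀ᶠ k in atTop, ∀ q ∈ u, q ∈ Set.range (φ k) := by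
      rw [Filter.eventually_all_finset]
      intro q _
      have htop : Tendsto (fun k : ℕ => (p : ℝ) ^ k) atTop atTop :=
        tendsto_pow_atTop_atTop_of_one_lt (show (1 : ℝ) < p from mod_cast hp.out.one_lt)
      filter_upwards [htop.eventually_ge_atTop ‖((q : ℚ) : ℚ_[p])‖] with k hk
      obtain ⟨l, hl⟩ := (norm_le_pow_iff p q.2 k).1 hk
      exact ⟨l, Subtype.ext hl.symm⟩
    refine ge_of_tendsto hs ?_
    filter_upwards [hu] with k hk
    have h1 : HasSum ((Set.range (φ k)).indicator a) (t k) := by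
      rw [← (hφ k).hasSum_iff fun q hq => Set.indicator_of_notMem hq _]
      exact (ht k).of_eq (fun j => Set.indicator_of_mem (Set.mem_range_self j) a) rfl
    calc ∑ q ∈ u, a q = ∑ q ∈ u, (Set.range (φ k)).indicator a q :=
          Finset.sum_congr rfl fun q hq => (Set.indicator_of_mem (hk q hq) _).symm
      _ ≤ t k := sum_le_hasSum u (fun q _ => Set.indicator_nonneg (fun q _ => ha q) q) h1
  have hsum : Summable a := summable_of_sum_le ha hle
  have h1 : ∑' q, a q ≤ s := hsum.tsum_le_of_sum_le hle
  have h2 : s ≤ ∑' q, a q := by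
    refine le_of_tendsto' hs fun k => ?_
    rw [← (ht k).tsum_eq]
    exact (ht k).summable.tsum_le_tsum_of_inj (φ k) (hφ k) (fun q _ => ha q) (fun j => le_rfl) hsum
  rw [← le_antisymm h1 h2]
  exact hsum.hasSum

/-- A character is multiplicative, so twisting by it commutes with convolution. The integral of a
convolution is the product of the integrals, and the involution conjugates the second factor. -/
theorem dualFourier_convolution_starInvolution {f : ℚ_[p] → ℂ} (hf : Continuous f)
    (hfs : HasCompactSupport f) (χ : AddDual ℚ_[p]) :
    dualFourier (padicHaar p)
        (f ⋆[ContinuousLinearMap.mul ℂ ℂ, padicHaar p] starInvolution f) χ =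
      ((‖dualFourier (padicHaar p) f χ‖ ^ 2 : ℝ) : ℂ) := by
  let e : ℚ_[p] → ℂ := fun x => (starRingEnd ℂ) ((χ (Multiplicative.ofAdd x) : Circle) : ℂ)
  have he : Continuous e := Complex.continuous_conj.comp (continuous_subtype_val.comp
    ((map_continuous χ).comp continuous_ofAdd))
  have hadd : ∀ x y, e (x + y) = e x * e y := by
    intro x y
    simp only [e, ofAdd_add, map_mul, Circle.coe_mul]
  have hneg : ∀ x, e (-x) = (starRingEnd ℂ) (e x) := by
    intro x
    simp only [e, ofAdd_neg, map_inv, Circle.coe_inv_eq_conj]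
  have hstar : Continuous (starInvolution f) :=
    Complex.continuous_conj.comp (hf.comp continuous_neg)
  have hstars : HasCompactSupport (starInvolution f) := by
    have : HasCompactSupport fun x => f (-x) := hfs.comp_homeomorph (Homeomorph.neg ℚ_[p])
    exact this.comp_left (map_zero _)
  have hconv : ∀ x, (f ⋆[ContinuousLinearMap.mul ℂ ℂ, padicHaar p] starInvolution f) x * e x =
      ((fun y => f y * e y) ⋆[ContinuousLinearMap.mul ℂ ℂ, padicHaar p]
        fun y => starInvolution f y * e y) x := by
    intro x
    simp only [convolution, ContinuousLinearMap.mul_apply']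
    rw [← integral_mul_const]
    congr 1
    ext t
    have : e x = e t * e (x - t) := by rw [← hadd, add_sub_cancel]
    rw [this]
    ring
  have hint1 : Integrable (fun y => f y * e y) (padicHaar p) :=
    (hf.mul he).integrable_of_hasCompactSupport hfs.mul_right
  have hint2 : Integrable (fun y => starInvolution f y * e y) (padicHaar p) :=
    (hstar.mul he).integrable_of_hasCompactSupport hstars.mul_right
  have hstarF : ∫ x, starInvolution f x * e x ∂(padicHaar p) =
      (starRingEnd ℂ) (∫ x, f x * e x ∂(padicHaar p)) := by
    rw [← integral_conj, ← integral_neg_eq_self]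
    congr 1
    ext x
    simp only [starInvolution, neg_neg, hneg, map_mul]
  calc _ = ∫ x, (f ⋆[ContinuousLinearMap.mul ℂ ℂ, padicHaar p] starInvolution f) x * e x
        ∂(padicHaar p) := rfl
    _ = (∫ x, f x * e x ∂(padicHaar p)) * (starRingEnd ℂ) (∫ x, f x * e x ∂(padicHaar p)) := by
        simp only [hconv]
        rw [integral_convolution _ hint1 hint2, ContinuousLinearMap.mul_apply', hstarF]
    _ = _ := by
        rw [Complex.mul_conj, Complex.normSq_eq_norm_sq]
        rfl

theorem continuous_convolution_starInvolution {f : ℚ_[p] → ℂ} (hf : Continuous f)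
    (hfs : HasCompactSupport f) :
    Continuous (f ⋆[ContinuousLinearMap.mul ℂ ℂ, padicHaar p] starInvolution f) :=
  hfs.continuous_convolution_left _ hf
    (Complex.continuous_conj.comp (hf.comp continuous_neg)).locallyIntegrable

theorem hasCompactSupport_convolution_starInvolution {f : ℚ_[p] → ℂ}
    (hfs : HasCompactSupport f) :
    HasCompactSupport (f ⋆[ContinuousLinearMap.mul ℂ ℂ, padicHaar p] starInvolution f) := by
  have : HasCompactSupport fun x => f (-x) := hfs.comp_homeomorph (Homeomorph.neg ℚ_[p])
  exact hfs.convolution _ (this.comp_left (map_zero (starRingEnd ℂ)))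

/-- Poisson summation for the lattice, in terms of `|f̂|²`. -/
theorem hasSum_triangleHat_normSq_dualFourier {f : ℚ_[p] → ℂ} (hf : Continuous f)
    (hfs : HasCompactSupport f) :
    ∃ s : ℝ, HasSum (fun q : intInvP p => triangleHat ((q : ℚ) : ℝ) *
        ‖dualFourier (padicHaar p) f (padicToDual p ((q : ℚ) : ℚ_[p]))‖ ^ 2) s ∧
      (s : ℂ) = ∫ x, (f ⋆[ContinuousLinearMap.mul ℂ ℂ, padicHaar p] starInvolution f) x
        ∂(padicAutocorrelation p) := by
  have hg := continuous_convolution_starInvolution p hf hfs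
  have hgs := hasCompactSupport_convolution_starInvolution p hfs
  set g := f ⋆[ContinuousLinearMap.mul ℂ ℂ, padicHaar p] starInvolution f with hgdef
  have hint : Integrable g (padicHaar p) := hg.integrable_of_hasCompactSupport hgs
  have hlim := tendsto_tsum_triangleHat_dualFourier p hg hgs
  let a : intInvP p → ℝ := fun q => triangleHat ((q : ℚ) : ℝ) *
    ‖dualFourier (padicHaar p) f (padicToDual p ((q : ℚ) : ℚ_[p]))‖ ^ 2
  have hterm : ∀ (k : ℕ) (j : ℤ), (triangleHat (j / (p : ℝ) ^ k) : ℂ) *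
      dualFourier (padicHaar p) g (padicToDual p (((j : ℚ) / (p : ℚ) ^ k : ℚ) : ℚ_[p])) =
      ((a ⟨_, intCast_div_pow_mem_intInvP p j k⟩ : ℝ) : ℂ) := by
    intro k j
    rw [hgdef, dualFourier_convolution_starInvolution p hf hfs, ← Complex.ofReal_mul]
    simp only [a]
    push_cast
    rfl
  have hsummable : ∀ k : ℕ,
      Summable fun j : ℤ => a ⟨_, intCast_div_pow_mem_intInvP p j k⟩ := by
    intro k
    have := (hasSum_triangleHat_dualFourier p k hint).summable
    simp only [hterm] at this
    exact Complex.summable_ofReal.1 this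
  simp only [hterm, ← Complex.ofReal_tsum] at hlim
  -- The partial sums are real, so they converge to the real part of the limit; comparison of limits
  -- at the end shows that the limit is itself real.
  have hre := (Complex.continuous_re.tendsto _).comp hlim
  refine ⟨_, hasSum_intInvP_of_tendsto p (a := a)
    (fun q => mul_nonneg (triangleHat_nonneg _) (sq_nonneg _))
    (fun k => (hsummable k).hasSum) hre, ?_⟩
  exact tendsto_nhds_unique ((Complex.continuous_ofReal.tendsto _).comp hre) hlim

end PadicPoisson

/-! ### Existence of the centered diffraction -/

section Diffraction

open Filter Topology

variable (p : ℕ) [hp : Fact p.Prime]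

/-- The indicator function of `p ^ k ℤ_p`. -/
def ballInd (k : ℕ) : ℚ_[p] → ℂ :=
  (Metric.closedBall 0 ((p : ℝ) ^ k)⁻¹).indicator 1

theorem continuous_ballInd (k : ℕ) : Continuous (ballInd p k) := by
  refine continuous_one.indicator fun x hx => ?_
  rw [(IsUltrametricDist.isClopen_closedBall (0 : ℚ_[p])
    (inv_pos.2 (cast_p_pow_pos p k)).ne').frontier_eq] at hx
  exact hx.elim

theorem hasCompactSupport_ballInd (k : ℕ) : HasCompactSupport (ballInd p k) :=
  HasCompactSupport.intro (isCompact_closedBall 0 ((p : ℝ) ^ k)⁻¹)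
    fun _ hx => Set.indicator_of_notMem hx _

/-- The characters whose values on `p ^ k ℤ_p` have real part larger than `1/2`. -/
def dualNhds (k : ℕ) : Set (AddDual ℚ_[p]) :=
  {χ | ∀ x : ℚ_[p], ‖x‖ ≤ ((p : ℝ) ^ k)⁻¹ →
    1 / 2 < ((χ (Multiplicative.ofAdd x) : Circle) : ℂ).re}

theorem isOpen_dualNhds (k : ℕ) : IsOpen (dualNhds p k) := by
  have hK : IsCompact (Multiplicative.toAdd ⁻¹' Metric.closedBall (0 : ℚ_[p]) ((p : ℝ) ^ k)⁻¹ :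
      Set (Multiplicative ℚ_[p])) := isCompact_closedBall (0 : ℚ_[p]) ((p : ℝ) ^ k)⁻¹
  have hU : IsOpen {z : Circle | 1 / 2 < (z : ℂ).re} :=
    isOpen_lt continuous_const (Complex.continuous_re.comp continuous_subtype_val)
  have hopen := (ContinuousMap.isOpen_setOfPred_mapsTo hK hU).preimage
    (ContinuousMonoidHom.isInducing_toContinuousMap (Multiplicative ℚ_[p]) Circle).continuous
  refine (congrArg IsOpen (Set.ext fun χ => ?_)).mpr hopen
  constructor
  · exact fun h x hx => h x.toAdd (mem_closedBall_zero_iff.1 hx)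
  · exact fun h x hx => h (mem_closedBall_zero_iff.2 hx)

theorem dualNhds_mono {k l : ℕ} (h : k ≤ l) : dualNhds p k ⊆ dualNhds p l := fun _ hχ x hx =>
  hχ x (hx.trans (inv_anti₀ (cast_p_pow_pos p k)
    (pow_le_pow_right₀ (mod_cast hp.out.one_le) h)))

/-- By continuity at 0 these increasing open sets exhaust the dual, so each compact set of
characters lies in one of them. -/
theorem exists_mem_dualNhds (χ : AddDual ℚ_[p]) : ∃ k, χ ∈ dualNhds p k := by
  have hcont : Continuous fun x : ℚ_[p] => ((χ (Multiplicative.ofAdd x) : Circle) : ℂ).re :=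
    Complex.continuous_re.comp (continuous_subtype_val.comp
      ((map_continuous χ).comp continuous_ofAdd))
  have h0 : ∀ᶠ x in 𝓝 (0 : ℚ_[p]), 1 / 2 < ((χ (Multiplicative.ofAdd x) : Circle) : ℂ).re := by
    refine hcont.continuousAt.eventually (lt_mem_nhds ?_)
    have : χ (Multiplicative.ofAdd 0) = 1 := map_one χ
    simp only [this]
    norm_num
  obtain ⟨ε, hε, h⟩ := Metric.eventually_nhds_iff.1 h0
  obtain ⟨k, hk⟩ := ((tendsto_inv_cast_pow p).eventually (gt_mem_nhds hε)).exists
  exact ⟨k, fun x hx => h (by rw [dist_zero_right]; exact hx.trans_lt hk)⟩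

theorem one_mem_dualNhds (k : ℕ) : (1 : AddDual ℚ_[p]) ∈ dualNhds p k := fun x _ => by
  have : (1 : AddDual ℚ_[p]) (Multiplicative.ofAdd x) = 1 := rfl
  rw [this]
  norm_num

theorem padicToDual_mem_dualNhds {y : ℚ_[p]} (hy : y ∈ padicUnitBall p) :
    padicToDual p y ∈ dualNhds p 0 := fun x hx => by
  rw [pow_zero, inv_one] at hx
  rw [coe_padicToDual_apply, padicAlpha_eq_one]
  · norm_num
  · rw [norm_mul]
    exact mul_le_one₀ hy (norm_nonneg _) hx

/-- The transform is the integral of the conjugate character over p^k ℤ_p, where its real part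
exceeds 1/2. This lower bound serves both local finiteness and vanishing. -/
theorem le_norm_dualFourier_ballInd {k : ℕ} {χ : AddDual ℚ_[p]} (hχ : χ ∈ dualNhds p k) :
    1 / 2 * ((p : ℝ) ^ k)⁻¹ ≤ ‖dualFourier (padicHaar p) (ballInd p k) χ‖ := by
  have hcont : Continuous fun x : ℚ_[p] =>
      (starRingEnd ℂ) ((χ (Multiplicative.ofAdd x) : Circle) : ℂ) :=
    Complex.continuous_conj.comp (continuous_subtype_val.comp
      ((map_continuous χ).comp continuous_ofAdd))
  set B := Metric.closedBall (0 : ℚ_[p]) ((p : ℝ) ^ k)⁻¹ with hB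
  have hBm : MeasurableSet B := Metric.isClosed_closedBall.measurableSet
  have hBc : IsCompact B := isCompact_closedBall _ _
  have hint := hcont.continuousOn.integrableOn_compact (μ := padicHaar p) hBc
  have e : dualFourier (padicHaar p) (ballInd p k) χ =
      ∫ x in B, (starRingEnd ℂ) ((χ (Multiplicative.ofAdd x) : Circle) : ℂ) ∂(padicHaar p) := by
    rw [← integral_indicator hBm, dualFourier]
    congr 1
    ext x
    by_cases hx : x ∈ B <;> simp [ballInd, ← hB, hx]
  refine le_trans ?_ (Complex.re_le_norm _)
  have hre : (∫ x in B, (starRingEnd ℂ) ((χ (Multiplicative.ofAdd x) : Circle) : ℂ)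
      ∂(padicHaar p)).re = ∫ x in B, ((χ (Multiplicative.ofAdd x) : Circle) : ℂ).re
        ∂(padicHaar p) := by
    have := integral_re (𝕜 := ℂ) hint
    simp only [RCLike.re_to_complex, Complex.conj_re] at this
    exact this.symm
  have hint' : IntegrableOn (fun x : ℚ_[p] => ((χ (Multiplicative.ofAdd x) : Circle) : ℂ).re) B
      (padicHaar p) := by
    have := hint.re
    simp only [RCLike.re_to_complex, Complex.conj_re] at this
    exact this
  rw [e, hre, ← padicHaar_closedBall_center p k 0]
  calc _ = ∫ _ in B, (1 / 2 : ℝ) ∂(padicHaar p) := by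
        rw [setIntegral_const, smul_eq_mul, mul_comm]
    _ ≤ _ := setIntegral_mono_on (integrableOn_const hBc.measure_lt_top.ne) hint' hBm
        fun x hx => (hχ x (mem_closedBall_zero_iff.1 hx)).le

/-- The centered diffraction `∑_{ξ ≠ 0} (sin(πξ) / (πξ))² δ_{α_ξ}` of the process. -/
def padicDiffraction : Measure (AddDual ℚ_[p]) :=
  Measure.sum fun q : intInvP p =>
    (if q = 0 then 0 else ENNReal.ofReal (triangleHat ((q : ℚ) : ℝ))) •
      Measure.dirac (padicToDual p ((q : ℚ) : ℚ_[p]))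

theorem integral_convolution_starInvolution {f : ℚ_[p] → ℂ} (hf : Continuous f)
    (hfs : HasCompactSupport f) :
    ∫ x, (f ⋆[ContinuousLinearMap.mul ℂ ℂ, padicHaar p] starInvolution f) x ∂(padicHaar p) =
      ((‖dualFourier (padicHaar p) f (padicToDual p 0)‖ ^ 2 : ℝ) : ℂ) := by
  rw [← dualFourier_convolution_starInvolution p hf hfs, padicToDual_zero, dualFourier]
  congr 1
  ext x
  have : (1 : AddDual ℚ_[p]) (Multiplicative.ofAdd x) = 1 := rfl
  rw [this, Circle.coe_one, map_one, mul_one]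

theorem lintegral_padicDiffraction {f : ℚ_[p] → ℂ} (hf : Continuous f)
    (hfs : HasCompactSupport f) :
    ∃ t : ℝ, 0 ≤ t ∧
      ∫⁻ χ, ENNReal.ofReal (‖dualFourier (padicHaar p) f χ‖ ^ 2) ∂(padicDiffraction p) =
        ENNReal.ofReal t ∧
      (t : ℂ) = centeredIntegral (padicHaar p) (padicAutocorrelation p) 1
        (f ⋆[ContinuousLinearMap.mul ℂ ℂ, padicHaar p] starInvolution f) := by
  obtain ⟨s, hs, hs'⟩ := hasSum_triangleHat_normSq_dualFourier p hf hfs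
  set a : intInvP p → ℝ := fun q => triangleHat ((q : ℚ) : ℝ) *
    ‖dualFourier (padicHaar p) f (padicToDual p ((q : ℚ) : ℚ_[p]))‖ ^ 2 with ha
  have hnonneg : ∀ q, 0 ≤ (if q = 0 then 0 else a q) := fun q => by
    split_ifs
    · exact le_rfl
    · exact mul_nonneg (triangleHat_nonneg _) (sq_nonneg _)
  -- Deleting the term q = 0 subtracts |f̂(1)|² = m(f * f*), since Λ̂(0) = 1. With intensity 1 this
  -- is exactly the centering.
  have hsum := hasSum_ite_sub_hasSum hs 0
  refine ⟨_, hsum.nonneg hnonneg, ?_, ?_⟩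
  · rw [padicDiffraction, lintegral_sum_measure, ← hsum.tsum_eq,
      ENNReal.ofReal_tsum_of_nonneg hnonneg hsum.summable]
    refine tsum_congr fun q => ?_
    rw [lintegral_smul_measure, lintegral_dirac, smul_eq_mul]
    split_ifs
    · rw [zero_mul, ENNReal.ofReal_zero]
    · rw [ha, ENNReal.ofReal_mul (triangleHat_nonneg _)]
  · rw [centeredIntegral, ← hs', integral_convolution_starInvolution p hf hfs]
    simp [ha, triangleHat]

instance padicDiffraction.instIsFiniteMeasureOnCompacts :
    IsFiniteMeasureOnCompacts (padicDiffraction p) := by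
  refine ⟨fun K hK => ?_⟩
  obtain ⟨k, hk⟩ := hK.elim_directed_cover (dualNhds p) (isOpen_dualNhds p)
    (fun χ _ => Set.mem_iUnion.2 (exists_mem_dualNhds p χ))
    (Monotone.directed_le fun _ _ h => dualNhds_mono p h)
  obtain ⟨t, -, ht, -⟩ := lintegral_padicDiffraction p (continuous_ballInd p k)
    (hasCompactSupport_ballInd p k)
  set c : ℝ := (1 / 2 * ((p : ℝ) ^ k)⁻¹) ^ 2 with hc
  have hc0 : 0 < c := by
    have := cast_p_pow_pos p k
    positivity
  -- Markov's inequality for |f̂|² with f the indicator of p^k ℤ_p, whose integral is already known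
  -- to be finite.
  have hle : ENNReal.ofReal c * padicDiffraction p (dualNhds p k) ≤ ENNReal.ofReal t := by
    rw [← ht, ← setLIntegral_const]
    refine le_trans (setLIntegral_mono' (isOpen_dualNhds p k).measurableSet fun χ hχ => ?_)
      (setLIntegral_le_lintegral _ _)
    refine ENNReal.ofReal_le_ofReal (pow_le_pow_left₀ ?_ (le_norm_dualFourier_ballInd p hχ) 2)
    have := cast_p_pow_pos p k
    positivity
  refine (measure_mono hk).trans_lt (lt_top_iff_ne_top.2 fun htop => ?_)
  rw [htop, ENNReal.mul_top (ENNReal.ofReal_pos.2 hc0).ne'] at hle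
  exact absurd hle (not_le.2 ENNReal.ofReal_lt_top)

theorem isMeasureFourierTransform_padicDiffraction :
    IsMeasureFourierTransform (padicHaar p)
      (centeredIntegral (padicHaar p) (padicAutocorrelation p) 1) (padicDiffraction p) := by
  -- No regularity of f̂ is needed, since the measure is a countable sum of point masses.
  have hmeas : ∀ f : ℚ_[p] → ℂ, AEStronglyMeasurable
      (fun χ => ‖dualFourier (padicHaar p) f χ‖ ^ 2) (padicDiffraction p) := by
    intro f
    rw [padicDiffraction, aestronglyMeasurable_sum_measure_iff]
    exact fun q => aestronglyMeasurable_dirac.smul_measure _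
  have hnonneg : ∀ f : ℚ_[p] → ℂ, 0 ≤ᵐ[padicDiffraction p]
      fun χ => ‖dualFourier (padicHaar p) f χ‖ ^ 2 := fun f =>
    Eventually.of_forall fun χ => sq_nonneg _
  refine ⟨inferInstance, fun f hf hfs => ⟨hmeas f, ?_⟩, fun f hf hfs => ?_⟩
  · obtain ⟨t, -, ht, -⟩ := lintegral_padicDiffraction p hf hfs
    rw [hasFiniteIntegral_iff_ofReal (hnonneg f), ht]
    exact ENNReal.ofReal_lt_top
  · obtain ⟨t, ht0, ht, ht'⟩ := lintegral_padicDiffraction p hf hfs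
    rw [integral_eq_lintegral_of_nonneg_ae (hnonneg f) (hmeas f), ht, ENNReal.toReal_ofReal ht0,
      ht']

theorem isCenteredDiffraction_padicDiffraction :
    IsCenteredDiffraction (padicHaar p) (solenoidMeasure p) (padicProcess p)
      (padicDiffraction p) :=
  ⟨1, padicAutocorrelation p, isIntensity_padicProcess p, isAutocorrelation_padicProcess p,
    isMeasureFourierTransform_padicDiffraction p⟩

/-! ### Vanishing of every centered diffraction near the characters of ℤ_p -/

theorem measurableSet_padicUnitBall : MeasurableSet (padicUnitBall p) := by
  rw [padicUnitBall_eq]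
  exact Metric.isClosed_closedBall.measurableSet

theorem integral_indicator_padicUnitBall (ζ : Measure ℚ_[p]) :
    ∫ x, (padicUnitBall p).indicator (1 : ℚ_[p] → ℂ) x ∂ζ = ((ζ (padicUnitBall p)).toReal : ℂ) := by
  rw [integral_indicator (measurableSet_padicUnitBall p)]
  simp [Measure.real]

/-- The lattice elements over ℤ_p are the integers, and Λ vanishes at all of them except 0. The
choice of a window of length 1 enters here. -/
theorem padicAutocorrelation_unitBall : padicAutocorrelation p (padicUnitBall p) = 1 := by
  have hm := measurableSet_padicUnitBall p
  rw [← lintegral_indicator_one hm, lintegral_padicAutocorrelation, tsum_eq_single 0]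
  · have : (0 : ℚ_[p]) ∈ padicUnitBall p := by simp [padicUnitBall]
    simp [triangle, this]
  · intro γ hγ
    by_cases h : (γ : ℚ_[p] × ℝ).1 ∈ padicUnitBall p
    · obtain ⟨⟨q, hq⟩, rfl⟩ := (latticeEquiv p).surjective γ
      obtain ⟨k, rfl⟩ := exists_int_of_norm_le_one p hq h
      have hk : k ≠ 0 := by
        rintro rfl
        exact hγ (Subtype.ext (Prod.ext (by simp) (by simp)))
      have h1 : (1 : ℝ) ≤ |(((k : ℚ)) : ℝ)| := by
        rw [Rat.cast_intCast]
        exact_mod_cast Int.one_le_abs hk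
      rw [latticeEquiv_snd, triangle_eq_zero h1, ENNReal.ofReal_zero, zero_mul]
    · rw [Set.indicator_of_notMem h, mul_zero]

theorem IsAutocorrelation.unitBall_eq_one {η : Measure ℚ_[p]}
    (h : IsAutocorrelation (padicHaar p) (solenoidMeasure p) (padicProcess p) η) :
    η (padicUnitBall p) = 1 := by
  have hm := measurableSet_padicUnitBall p
  -- The shear (x, t) ↦ (x + t, t) preserves ℤ_p × ℤ_p because ℤ_p is a group. The second moment of
  -- this set therefore determines the mass that any autocorrelation gives to ℤ_p.
  have key : ∀ ζ : Measure ℚ_[p], ((ζ.prod (padicHaar p)).map fun z : ℚ_[p] × ℚ_[p] =>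
      (z.1 + z.2, z.2)) (padicUnitBall p ×ˢ padicUnitBall p) = ζ (padicUnitBall p) := by
    intro ζ
    have e : (fun z : ℚ_[p] × ℚ_[p] => (z.1 + z.2, z.2)) ⁻¹' (padicUnitBall p ×ˢ padicUnitBall p) =
        padicUnitBall p ×ˢ padicUnitBall p := by
      ext z
      simp only [padicUnitBall, Set.mem_preimage, Set.mem_prod, Set.mem_ofPred_eq]
      refine and_congr_left fun h2 => ⟨fun h1 => ?_, fun h1 => ?_⟩
      · have e1 : z.1 = z.1 + z.2 + -z.2 := by ring
        rw [e1]
        refine (Padic.nonarchimedean _ _).trans (max_le h1 ?_)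
        rwa [norm_neg]
      · exact (Padic.nonarchimedean _ _).trans (max_le h1 h2)
    have hmap : Measurable fun z : ℚ_[p] × ℚ_[p] => (z.1 + z.2, z.2) :=
      (measurable_fst.add measurable_snd).prodMk measurable_snd
    rw [Measure.map_apply hmap (hm.prod hm), e, Measure.prod_prod, padicHaar_unitBall, mul_one]
  rw [← key η, ← h.secondMoment_eq, (isAutocorrelation_padicProcess p).secondMoment_eq, key,
    padicAutocorrelation_unitBall]

theorem IsIntensity.eq_one {i : ℝ≥0}
    (h : IsIntensity (padicHaar p) (solenoidMeasure p) (padicProcess p) i) : i = 1 := by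
  have h1 : i • padicHaar p = (1 : ℝ≥0) • padicHaar p := h.symm.trans (isIntensity_padicProcess p)
  have h2 := congrArg (fun ζ : Measure ℚ_[p] => ζ (padicUnitBall p)) h1
  simp only [Measure.smul_apply, padicHaar_unitBall, ENNReal.smul_def, smul_eq_mul, mul_one] at h2
  exact_mod_cast h2

/-- As ℤ_p is a subgroup of Haar measure 1, its indicator is symmetric and idempotent under
convolution. -/
theorem convolution_ballInd_zero :
    (ballInd p 0 ⋆[ContinuousLinearMap.mul ℂ ℂ, padicHaar p] starInvolution (ballInd p 0)) =
      (padicUnitBall p).indicator 1 := by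
  have hball : ballInd p 0 = (padicUnitBall p).indicator 1 := by
    rw [ballInd, padicUnitBall_eq, pow_zero, inv_one]
  have hint : ∫ t, (padicUnitBall p).indicator (1 : ℚ_[p] → ℂ) t ∂(padicHaar p) = 1 := by
    rw [integral_indicator_padicUnitBall, padicHaar_unitBall]
    simp
  ext x
  rw [convolution]
  have e : ∀ t, (ContinuousLinearMap.mul ℂ ℂ) (ballInd p 0 t)
      (starInvolution (ballInd p 0) (x - t)) =
      (padicUnitBall p).indicator 1 x * (padicUnitBall p).indicator (1 : ℚ_[p] → ℂ) t := by
    intro t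
    rw [ContinuousLinearMap.mul_apply', starInvolution, hball, neg_sub]
    by_cases ht : t ∈ padicUnitBall p
    · have hiff : t - x ∈ padicUnitBall p ↔ x ∈ padicUnitBall p := by
        have ht' : ‖t‖ ≤ 1 := ht
        constructor
        · intro h
          have e1 : x = t + -(t - x) := by ring
          change ‖x‖ ≤ 1
          rw [e1]
          refine (Padic.nonarchimedean _ _).trans (max_le ht' ?_)
          rw [norm_neg]
          exact h
        · intro h
          change ‖t - x‖ ≤ 1
          rw [sub_eq_add_neg]
          refine (Padic.nonarchimedean _ _).trans (max_le ht' ?_)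
          rw [norm_neg]
          exact h
      by_cases hx : x ∈ padicUnitBall p <;> simp [ht, hx, hiff]
    · simp [ht]
  simp only [e]
  rw [integral_const_mul, hint, mul_one]

/-- The diffraction of the process vanishes in a neighborhood of the annihilator of `ℤ_p`. -/
theorem IsCenteredDiffraction.dualNhds_eq_zero {ν : Measure (AddDual ℚ_[p])}
    (h : IsCenteredDiffraction (padicHaar p) (solenoidMeasure p) (padicProcess p) ν) :
    ν (dualNhds p 0) = 0 := by
  obtain ⟨i, η, hi, hη, hν⟩ := h
  -- The value is η⁺(ℤ_p) - i² m(ℤ_p) = 1 - 1.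
  have hzero : ∫ χ, ‖dualFourier (padicHaar p) (ballInd p 0) χ‖ ^ 2 ∂ν = 0 := by
    have := hν.integral_eq _ (continuous_ballInd p 0) (hasCompactSupport_ballInd p 0)
    rw [convolution_ballInd_zero, centeredIntegral, integral_indicator_padicUnitBall,
      integral_indicator_padicUnitBall, padicHaar_unitBall,
      hη.unitBall_eq_one, hi.eq_one] at this
    simpa using this
  rw [integral_eq_zero_iff_of_nonneg (fun χ => sq_nonneg _)
    (hν.integrable _ (continuous_ballInd p 0) (hasCompactSupport_ballInd p 0))] at hzero
  refine measure_mono_null (fun χ hχ => ?_) (ae_iff.1 hzero)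
  have h1 := le_norm_dualFourier_ballInd p hχ
  rw [pow_zero, inv_one, mul_one] at h1
  have h2 : 0 < ‖dualFourier (padicHaar p) (ballInd p 0) χ‖ := by linarith
  exact (pow_pos h2 2).ne'

theorem isStealthy_padicProcess :
    IsStealthy (padicHaar p) (solenoidMeasure p) (padicProcess p) where
  randomMeasure := isInvariantRandomMeasure_padicProcess p
  pointProcess := isSimplePointProcess_padicProcess p
  squareIntegrable := isLocallySquareIntegrable_padicProcess p
  vanishing := ⟨padicDiffraction p, isCenteredDiffraction_padicDiffraction p, dualNhds p 0,
    isOpen_dualNhds p 0, ⟨1, one_mem_dualNhds p 0⟩,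
    (isCenteredDiffraction_padicDiffraction p).dualNhds_eq_zero⟩

end Diffraction

end

theorem mainTheorem8 (p : ℕ) [Fact p.Prime] :
    IsCutAndProjectDatum (padicLattice p) halfWindow ∧
    (∃! P : Measure ((ℚ_[p] × ℝ) ⧸ padicLattice p), IsInvariantProbability ℚ_[p] P) ∧
    ∀ P : Measure ((ℚ_[p] × ℝ) ⧸ padicLattice p), IsInvariantProbability ℚ_[p] P →
      (∃ ν : Measure (AddDual ℚ_[p]), IsCenteredDiffraction (padicHaar p) P
        (cutAndProjectProcess (padicLattice p) halfWindow) ν) ∧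
      (∀ ν : Measure (AddDual ℚ_[p]), IsCenteredDiffraction (padicHaar p) P
        (cutAndProjectProcess (padicLattice p) halfWindow) ν →
          ν (padicToDual p '' padicUnitBall p) = 0) ∧
      IsStealthy (padicHaar p) P (cutAndProjectProcess (padicLattice p) halfWindow) := by
  refine ⟨isCutAndProjectDatum_padicLattice p, ⟨solenoidMeasure p,
    isInvariantProbability_solenoidMeasure p, fun P hP => eq_solenoidMeasure p hP⟩,
    fun P hP => ?_⟩
  obtain rfl := eq_solenoidMeasure p hP
  refine ⟨⟨_, isCenteredDiffraction_padicDiffraction p⟩, fun ν hν => ?_,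
    isStealthy_padicProcess p⟩
  refine measure_mono_null ?_ (hν.dualNhds_eq_zero p)
  rintro _ ⟨y, hy, rfl⟩
  exact padicToDual_mem_dualNhds p hy
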